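/- For continuous rates $\lambda_1,\dots,\lambda_d : E \to [0,\infty)$ on $E=\mathbb R^d\times\{-1,+1\}^d$, the Zig-Zag process with switching rates $(\lambda_i)$ is the $E$-valued process $(\Xi(t),\Theta(t))_{t\ge 0}$ constructed as follows from $(T^0,\Xi^0,\Theta^0)=(0,\xi,\theta)$. Given $(T^{k-1},\Xi^{k-1},\Theta^{k-1})$, let $\tau^k_1,\dots,\tau^k_d\in[0,\infty]$ be independent with $$P(\tau^k_i\ge t)=\exp\Big(-\int_0^t\lambda_i(\Xi^{k-1}+\Theta^{k-1}s,\Theta^{k-1})\,ds\Big),$$ let $i_0$ be the index of the smallest $\tau^k_i$, put $T^k=T^{k-1}+\tau^k_{i_0}$, $\Xi^k=\Xi^{k-1}+\Theta^{k-1}\tau^k_{i_0}$, and let $\Theta^k$ be $\Theta^{k-1}$ with its $i_0$-th component flipped; the process is $(\Xi(t),\Theta(t))=(\Xi^k+\Theta^k(t-T^k),\Theta^k)$ for $t\in[T^k,T^{k+1})$. Let $P^t((\xi,\theta),\cdot)$ be the law of $(\Xi(t),\Theta(t))$ started at $(\xi,\theta)$. For a fixed $\delta>0$ the time-discretized process is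 the Markov chain with transition kernel $P^\delta$. A Markov chain with transition kernel $Q$ is mixing if there is a probability distribution $\nu$ with $\lim_{k\to\infty}\|Q^k(x,\cdot)-\nu\|_{\mathrm{TV}}=0$ for every initial state $x$. **Proposition 2.5.** Let $\Psi\in C^1(\mathbb R^d)$ with $Z=\int_{\mathbb R^d} e^{-\Psi(\xi)}\,d\xi<\infty$, and suppose that the target density $\pi=e^{-\Psi}/Z$ is of product form, $\pi(\xi)=\prod_{i=1}^d\pi_i(\xi_i)$ with positive one-dimensional probability densities $\pi_i$; write $\Psi(\xi)=\sum_{i=1}^d\Psi_i(\xi_i)$. Suppose the switching rates are continuous and of the form $$\lambda_i(\xi,\theta)=\big(\theta_i\Psi_i'(\xi_i)\big)^+ +\gamma_i(\xi_i),\qquad i=1,\dots,d,$$ with $\gamma_i:\mathbb R\to[0,\infty)$, so that $\lambda_i$ depends only on $(\xi_i,\theta_i)$. Fix $\delta>0$ and suppose that, for every $i=1,\dots,d$, the time-discretized one-dimensional Zig-Zag process on $\mathbb R\times\{-1,+1\}$ with switching rate $(u,v)\mapsto(v\Psi_i'(u))^++\gamma_i(u)$ is mixing. Then the time-discretized $d$-dimensional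 Zig-Zag process with switching rates $(\lambda_i)_{i=1}^d$ is mixing. In particular, the $d$-dimensional Zig-Zag process admits a unique invariant distribution, that is, there is exactly one probability measure $\mu$ on $E$ with $\mu P^t=\mu$ for all $t\ge 0$. -/

import Mathlib

open MeasureTheory ProbabilityTheory Filter Topology
open scoped NNReal ENNReal

noncomputable section

namespace ZigZag

/-- The state space `E = ℝ^d × {-1, +1}^d`; the group of units `ℤˣ` is the set `{-1, +1}`. -/
abbrev State (d : ℕ) : Type := (Fin d → ℝ) × (Fin d → ℤˣ)

/-- A sign, as a real number. -/
def sgn (u : ℤˣ) : ℝ := ((u : ℤ) : ℝ)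

/-- Switching rates: continuous functions `λ_i : E → [0, ∞)`, `i = 1, …, d`. -/
structure Rates (d : ℕ) where
  rate : Fin d → State d → ℝ
  nonneg : ∀ i x, 0 ≤ rate i x
  continuous : ∀ i, Continuous (rate i)

/-- The straight line `s ↦ ξ + θ s` with unchanged velocity `θ`. -/
def flow {d : ℕ} (x : State d) (s : ℝ) : State d :=
  (fun i => x.1 i + sgn (x.2 i) * s, x.2)

variable {d : ℕ}

/-- `∫_0^t λ_i(ξ + θ s, θ) ds`. -/
def Rates.cumul (Λ : Rates d) (i : Fin d) (x : State d) (t : ℝ) : ℝ :=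
  ∫ s in (0 : ℝ)..t, Λ.rate i (flow x s)

/-- The candidate switching time of coordinate `i` from state `x`: the first `t ≥ 0` at which
`∫_0^t λ_i(ξ + θ s, θ) ds` reaches the level `e` (`∞` if it never does). When `e` is
exponentially distributed with mean one, this is a random time `τ` with
`P(τ ≥ t) = exp (- ∫_0^t λ_i(ξ + θ s, θ) ds)`. -/
def Rates.clock (Λ : Rates d) (i : Fin d) (x : State d) (e : ℝ) : ℝ≥0∞ :=
  ⨅ (t : ℝ≥0) (_ : e ≤ Λ.cumul i x t), (t : ℝ≥0∞)

/-- `i` is the (first) index at which the family `τ` is minimal. -/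
def IsArgmin (τ : Fin d → ℝ≥0∞) (i : Fin d) : Prop :=
  (∀ j, τ i ≤ τ j) ∧ ∀ j, j < i → τ i < τ j

open Classical in
/-- One step of the skeleton chain: from `(T, Ξ, Θ)`, move along the straight line until the
smallest of the `d` candidate times `τ_i`, and flip the velocity coordinate at which the minimum is
attained. If no candidate time is finite the new time is `∞` and the new state is irrelevant. -/
def Rates.step (Λ : Rates d) (z : ℝ≥0∞ × State d) (e : Fin d → ℝ) : ℝ≥0∞ × State d :=
  let τ : Fin d → ℝ≥0∞ := fun i => Λ.clock i z.2 (e i)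
  let y : State d := flow z.2 (⨅ i, τ i).toReal
  (z.1 + ⨅ i, τ i, (y.1, fun i => if IsArgmin τ i then - y.2 i else y.2 i))

/-- The skeleton points `(T^k, Ξ^k, Θ^k)`, started at `(0, x)` and driven by the levels `ω`. -/
def Rates.skeleton (Λ : Rates d) (x : State d) (ω : ℕ → Fin d → ℝ) : ℕ → ℝ≥0∞ × State d
  | 0 => (0, x)
  | k + 1 => Λ.step (Λ.skeleton x ω k) (ω k)

/-- The number of switches up to time `t`: the first `k` with `t < T^{k+1}`. (If there is no such
`k`, an event of probability zero, this is `0` by convention.) -/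
def Rates.numSwitches (Λ : Rates d) (x : State d) (ω : ℕ → Fin d → ℝ) (t : ℝ≥0) : ℕ :=
  sInf {k : ℕ | (t : ℝ≥0∞) < (Λ.skeleton x ω (k + 1)).1}

/-- The trajectory: `(Ξ(t), Θ(t)) = (Ξ^k + Θ^k (t - T^k), Θ^k)` for `t ∈ [T^k, T^{k+1})`. -/
def Rates.path (Λ : Rates d) (x : State d) (ω : ℕ → Fin d → ℝ) (t : ℝ≥0) : State d :=
  let z := Λ.skeleton x ω (Λ.numSwitches x ω t)
  flow z.2 ((t : ℝ) - z.1.toReal)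

instance : IsProbabilityMeasure (expMeasure 1) := isProbabilityMeasure_expMeasure one_pos

/-- The law of the driving noise: independent exponential variables with mean one, `d` for each
step of the skeleton chain. -/
def noise (d : ℕ) : Measure (ℕ → Fin d → ℝ) :=
  Measure.infinitePi fun _ : ℕ => Measure.pi fun _ : Fin d => expMeasure 1

instance : IsProbabilityMeasure (noise d) := by unfold noise; infer_instance

/-! ### Measurability of the construction -/

instance : DiscreteMeasurableSpace ℤˣ :=
  ⟨fun s => ⟨Units.val '' s, MeasurableSet.of_discrete,
    Set.preimage_image_eq _ Units.val_injective⟩⟩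

theorem continuous_sgn : Continuous sgn := continuous_of_discreteTopology

theorem measurable_sgn : Measurable sgn := Measurable.of_discrete

theorem continuous_flow : Continuous fun p : State d × ℝ => flow p.1 p.2 := by
  unfold flow
  have := continuous_sgn
  fun_prop

theorem measurable_flow : Measurable fun p : State d × ℝ => flow p.1 p.2 := by
  unfold flow
  have := measurable_sgn
  refine Measurable.prodMk ?_ (by fun_prop)
  refine measurable_pi_lambda _ fun i => ?_
  fun_prop

theorem Rates.continuous_rate_flow (Λ : Rates d) (i : Fin d) :
    Continuous (Function.uncurry fun (x : State d) (s : ℝ) => Λ.rate i (flow x s)) :=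
  (Λ.continuous i).comp continuous_flow

theorem Rates.continuous_cumul (Λ : Rates d) (i : Fin d) (t : ℝ) :
    Continuous fun x : State d => Λ.cumul i x t :=
  intervalIntegral.continuous_parametric_intervalIntegral_of_continuous'
    (Λ.continuous_rate_flow i) 0 t

/-- On `ℤˣ` the Borel and the discrete σ-algebra agree. -/
instance : BorelSpace ℤˣ :=
  ⟨by
    refine le_antisymm (fun s _ => ?_) (fun s _ => MeasurableSet.of_discrete)
    exact MeasurableSpace.measurableSet_generateFrom (isOpen_discrete s)⟩

theorem Rates.cumul_mono (Λ : Rates d) (i : Fin d) (x : State d) {s t : ℝ} (h0 : 0 ≤ s)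
    (h : s ≤ t) : Λ.cumul i x s ≤ Λ.cumul i x t := by
  have hc : Continuous fun r : ℝ => Λ.rate i (flow x r) :=
    (Λ.continuous_rate_flow i).comp (by fun_prop : Continuous fun r : ℝ => (x, r))
  exact intervalIntegral.integral_mono_interval le_rfl h0 h
    (Eventually.of_forall fun r => Λ.nonneg i _) (hc.intervalIntegrable _ _)

theorem Rates.measurable_clock (Λ : Rates d) (i : Fin d) :
    Measurable fun p : State d × ℝ => Λ.clock i p.1 p.2 := by
  refine measurable_of_Iio fun a => ?_
  have : (fun p : State d × ℝ => Λ.clock i p.1 p.2) ⁻¹' Set.Iio a =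
      ⋃ q : ℚ, ⋃ _ : ((Real.toNNReal q : ℝ≥0) : ℝ≥0∞) < a,
        {p : State d × ℝ | p.2 ≤ Λ.cumul i p.1 (Real.toNNReal q : ℝ≥0)} := by
    ext p
    simp only [Set.mem_preimage, Set.mem_Iio, Rates.clock, iInf_lt_iff, Set.mem_iUnion,
      Set.mem_ofPred_eq, exists_prop]
    constructor
    · rintro ⟨t, ht, hta⟩
      obtain ⟨q, -, h1, h2⟩ := ENNReal.lt_iff_exists_rat_btwn.1 hta
      refine ⟨q, h2, ht.trans (Λ.cumul_mono i p.1 t.2 ?_)⟩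
      exact_mod_cast (ENNReal.coe_lt_coe.1 h1).le
    · rintro ⟨q, hq, h⟩
      exact ⟨_, h, hq⟩
  rw [this]
  refine MeasurableSet.iUnion fun q => MeasurableSet.iUnion fun _ => ?_
  exact measurableSet_le measurable_snd
    ((Λ.continuous_cumul i _).measurable.comp measurable_fst)

theorem Rates.measurable_step (Λ : Rates d) :
    Measurable fun p : (ℝ≥0∞ × State d) × (Fin d → ℝ) => Λ.step p.1 p.2 := by
  have hτ : ∀ i, Measurable fun p : (ℝ≥0∞ × State d) × (Fin d → ℝ) =>
      Λ.clock i p.1.2 (p.2 i) := fun i =>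
    (Λ.measurable_clock i).comp
      (by fun_prop : Measurable fun p : (ℝ≥0∞ × State d) × (Fin d → ℝ) => (p.1.2, p.2 i))
  have hmin : Measurable fun p : (ℝ≥0∞ × State d) × (Fin d → ℝ) =>
      ⨅ i, Λ.clock i p.1.2 (p.2 i) := Measurable.iInf hτ
  have hy : Measurable fun p : (ℝ≥0∞ × State d) × (Fin d → ℝ) =>
      flow p.1.2 (⨅ i, Λ.clock i p.1.2 (p.2 i)).toReal :=
    measurable_flow.comp ((measurable_snd.comp measurable_fst).prodMk hmin.ennreal_toReal)
  have hset : ∀ i, MeasurableSet {p : (ℝ≥0∞ × State d) × (Fin d → ℝ) |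
      IsArgmin (fun i => Λ.clock i p.1.2 (p.2 i)) i} := by
    intro i
    unfold IsArgmin
    simp only [Set.ofPred_and, Set.ofPred_forall]
    exact (MeasurableSet.iInter fun j => measurableSet_le (hτ i) (hτ j)).inter
      (MeasurableSet.iInter fun j => MeasurableSet.iInter fun _ =>
        measurableSet_lt (hτ i) (hτ j))
  unfold Rates.step
  refine Measurable.prodMk ((measurable_fst.comp measurable_fst).add hmin)
    (Measurable.prodMk (measurable_fst.comp hy) (measurable_pi_lambda _ fun i => ?_))
  have hyi : Measurable fun p : (ℝ≥0∞ × State d) × (Fin d → ℝ) =>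
      (flow p.1.2 (⨅ i, Λ.clock i p.1.2 (p.2 i)).toReal).2 i :=
    (measurable_pi_apply i).comp (measurable_snd.comp hy)
  exact Measurable.ite (hset i)
    ((Measurable.of_discrete (f := fun u : ℤˣ => -u)).comp hyi) hyi

theorem Rates.measurable_skeleton (Λ : Rates d) (k : ℕ) :
    Measurable fun p : State d × (ℕ → Fin d → ℝ) => Λ.skeleton p.1 p.2 k := by
  induction k with
  | zero => exact measurable_const.prodMk measurable_fst
  | succ k ih =>
    exact Λ.measurable_step.comp
      (ih.prodMk ((measurable_pi_apply k).comp measurable_snd))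

theorem Rates.measurable_numSwitches (Λ : Rates d) (t : ℝ≥0) :
    Measurable fun p : State d × (ℕ → Fin d → ℝ) => Λ.numSwitches p.1 p.2 t := by
  have hm : ∀ k : ℕ, MeasurableSet {p : State d × (ℕ → Fin d → ℝ) |
      (t : ℝ≥0∞) < (Λ.skeleton p.1 p.2 (k + 1)).1} := fun k =>
    measurableSet_lt measurable_const (measurable_fst.comp (Λ.measurable_skeleton (k + 1)))
  have hex : MeasurableSet {p : State d × (ℕ → Fin d → ℝ) |
      ∃ k : ℕ, (t : ℝ≥0∞) < (Λ.skeleton p.1 p.2 (k + 1)).1} := by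
    simp only [Set.ofPred_exists]
    exact MeasurableSet.iUnion hm
  classical
  have hle : ∀ n : ℕ, MeasurableSet {p : State d × (ℕ → Fin d → ℝ) |
      Λ.numSwitches p.1 p.2 t ≤ n} := by
    intro n
    have : {p : State d × (ℕ → Fin d → ℝ) | Λ.numSwitches p.1 p.2 t ≤ n} =
        (⋃ k : ℕ, ⋃ _ : k ≤ n, {p : State d × (ℕ → Fin d → ℝ) |
          (t : ℝ≥0∞) < (Λ.skeleton p.1 p.2 (k + 1)).1}) ∪
        {p : State d × (ℕ → Fin d → ℝ) |
          ∃ k : ℕ, (t : ℝ≥0∞) < (Λ.skeleton p.1 p.2 (k + 1)).1}ᶜ := by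
      ext p
      simp only [Set.mem_ofPred_eq, Set.mem_union, Set.mem_iUnion, Set.mem_compl_iff, exists_prop,
        Rates.numSwitches]
      constructor
      · intro h
        by_cases he : ∃ k : ℕ, (t : ℝ≥0∞) < (Λ.skeleton p.1 p.2 (k + 1)).1
        · exact Or.inl ⟨_, h, Nat.sInf_mem (s := {k : ℕ |
            (t : ℝ≥0∞) < (Λ.skeleton p.1 p.2 (k + 1)).1}) he⟩
        · exact Or.inr he
      · rintro (⟨k, hk, h⟩ | h)
        · exact (Nat.sInf_le h).trans hk
        · have : {k : ℕ | (t : ℝ≥0∞) < (Λ.skeleton p.1 p.2 (k + 1)).1} = ∅ := by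
            ext k
            simp only [Set.mem_ofPred_eq, Set.mem_empty_iff_false, iff_false]
            exact fun hk => h ⟨k, hk⟩
          simp [this]
    rw [this]
    exact (MeasurableSet.iUnion fun k => MeasurableSet.iUnion fun _ => hm k).union hex.compl
  exact measurable_of_Iic hle

theorem Rates.measurable_path (Λ : Rates d) (t : ℝ≥0) :
    Measurable fun p : State d × (ℕ → Fin d → ℝ) => Λ.path p.1 p.2 t := by
  have hz : Measurable fun p : State d × (ℕ → Fin d → ℝ) =>
      Λ.skeleton p.1 p.2 (Λ.numSwitches p.1 p.2 t) :=
    (measurable_from_prod_countable_right (f := fun q : ℕ × (State d × (ℕ → Fin d → ℝ)) =>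
      Λ.skeleton q.2.1 q.2.2 q.1) fun k => Λ.measurable_skeleton k).comp
      ((Λ.measurable_numSwitches t).prodMk measurable_id)
  exact measurable_flow.comp (hz.snd.prodMk (measurable_const.sub hz.fst.ennreal_toReal))

/-! ### Transition kernels -/

/-- The transition kernel `P^t` of the Zig-Zag process with switching rates `Λ`: the law of
`(Ξ(t), Θ(t))` as a function of the initial state. -/
def Rates.transition (Λ : Rates d) (t : ℝ≥0) : Kernel (State d) (State d) where
  toFun := fun x => (noise d).map fun ω => Λ.path x ω t
  measurable' := by
    refine Measure.measurable_of_measurable_coe _ fun s hs => ?_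
    have hx : ∀ x : State d, Measurable fun ω => Λ.path x ω t := fun x =>
      (Λ.measurable_path t).comp measurable_prodMk_left
    simp only [Measure.map_apply (hx _) hs]
    exact measurable_measure_prodMk_left (ν := noise d) (Λ.measurable_path t hs)

instance (Λ : Rates d) (t : ℝ≥0) : IsMarkovKernel (Λ.transition t) :=
  ⟨fun x => Measure.isProbabilityMeasure_map
    ((Λ.measurable_path t).comp measurable_prodMk_left).aemeasurable⟩

/-- A probability measure `μ` is invariant for the Zig-Zag process: `μ P^t = μ` for all `t ≥ 0`. -/
def Rates.IsInvariant (Λ : Rates d) (μ : Measure (State d)) : Prop :=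
  IsProbabilityMeasure μ ∧ ∀ t : ℝ≥0, (Λ.transition t).Invariant μ

/-! ### Mixing -/

instance isMarkovKernel_pow {E : Type*} [MeasurableSpace E] (κ : Kernel E E) [IsMarkovKernel κ]
    (k : ℕ) : IsMarkovKernel (κ ^ k) := by
  induction k with
  | zero => exact inferInstanceAs (IsMarkovKernel (Kernel.id : Kernel E E))
  | succ k ih =>
    rw [pow_succ]
    exact inferInstanceAs (IsMarkovKernel ((κ ^ k).comp κ))

/-- The total variation norm `‖μ - ν‖_TV` of the signed measure `μ - ν`. -/
def tvNorm {E : Type*} [MeasurableSpace E] (μ ν : Measure E) [IsFiniteMeasure μ]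
    [IsFiniteMeasure ν] : ℝ≥0∞ :=
  (μ.toSignedMeasure - ν.toSignedMeasure).totalVariation Set.univ

/-- The Markov chain with transition kernel `κ` is mixing: there is a probability distribution `μ`
with `‖κ^k(x, ·) - μ‖_TV → 0` as `k → ∞`, for every initial state `x`. -/
def IsMixing {E : Type*} [MeasurableSpace E] (κ : Kernel E E) [IsMarkovKernel κ] : Prop :=
  ∃ (μ : Measure E) (_ : IsProbabilityMeasure μ),
    ∀ x, Tendsto (fun k : ℕ => tvNorm ((κ ^ k) x) μ) atTop (𝓝 0)

/-! ### Targets -/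

/-- `Ψ` is a negative log density of the probability density `π`: `Ψ ∈ C^1(ℝ^d)`,
`Z = ∫ exp (-Ψ) < ∞` and `π = exp (-Ψ) / Z`. -/
structure IsNegLogDensity (Ψ π : (Fin d → ℝ) → ℝ) : Prop where
  contDiff : ContDiff ℝ 1 Ψ
  integrable : Integrable fun ξ => Real.exp (-Ψ ξ)
  density : ∀ ξ, π ξ = Real.exp (-Ψ ξ) / ∫ η, Real.exp (-Ψ η)

/-- `π` is of product form: a product of positive one-dimensional probability densities. -/
def IsProductForm (π : (Fin d → ℝ) → ℝ) : Prop :=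
  ∃ p : Fin d → ℝ → ℝ, (∀ i x, 0 < p i x) ∧ (∀ i, Integrable (p i) ∧ ∫ x, p i x = 1) ∧
    ∀ ξ, π ξ = ∏ i, p i (ξ i)

end ZigZag

end

/-! Each rate `λ_i` depends only on the `i`-th position and velocity, so the `d`-dimensional process
should be `d` independent one-dimensional processes run side by side. Granted this, `P^t` is a
product kernel. The total variation distance of products is controlled by the sum of the
coordinatewise distances, so mixing passes from the coordinates to the product.

Independence is not visible in the construction, where a switch in one coordinate redraws all the
clocks. It is proved analytically rather than by coupling. Conditioning on the first switch shows
that `u(t, x) = E f(Ξ(t), Θ(t))` satisfies a renewal equation (`semigroup_renewal`); this needs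
almost sure non-explosion and the joint law of the first switching time and index. Measurable `[0,
1]`-valued solutions are unique (`IsSolution.unique`): speeds are bounded, so only a compact cone
matters, and there the equation is a contraction. Products of one-dimensional solutions solve the
`d`-dimensional equation by the product rule (`isSolution_prod`). Uniqueness then identifies the
probabilities of boxes with products (`map_transition`).

The same uniqueness gives the Chapman–Kolmogorov equation, because a time-shifted solution is again
a solution. So `(P^δ)^k = P^(kδ)`, and `P^t` commutes with `P^(kδ)`. If `P^(kδ)(x, ·)` tends to `ν`
for every `x`, commuting makes `ν` invariant under every `P^t`, and integrating over an invariant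
law shows that it equals `ν`. -/

noncomputable section

namespace ZigZag

/-! ### Total variation -/

/-- `μ` exceeds `ν` by a finite measure of mass at most `ε`. -/
def ExcessLE {E : Type*} [MeasurableSpace E] (μ ν : Measure E) (ε : ℝ≥0∞) : Prop :=
  ∃ ρ : Measure E, IsFiniteMeasure ρ ∧ ρ Set.univ ≤ ε ∧ μ ≤ ν + ρ

section TV

variable {E F : Type*} [MeasurableSpace E] [MeasurableSpace F]

theorem ExcessLE.apply_le {μ ν : Measure E} {ε : ℝ≥0∞} (h : ExcessLE μ ν ε) (A : Set E) :
    μ A ≤ ν A + ε := by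
  obtain ⟨ρ, -, hε, hle⟩ := h
  calc μ A ≤ (ν + ρ) A := hle A
    _ = ν A + ρ A := by simp
    _ ≤ ν A + ε := by gcongr; exact (measure_mono (Set.subset_univ A)).trans hε

theorem tvNorm_comm (μ ν : Measure E) [IsFiniteMeasure μ] [IsFiniteMeasure ν] :
    tvNorm μ ν = tvNorm ν μ := by
  unfold tvNorm
  rw [← SignedMeasure.totalVariation_neg, neg_sub]

/-- The excess measure is the variation `|μ - ν|` itself. The one-sided relation passes through
pushforwards, kernels and products without any signed measure. -/
theorem excessLE_tvNorm (μ ν : Measure E) [IsFiniteMeasure μ] [IsFiniteMeasure ν] :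
    ExcessLE μ ν (tvNorm μ ν) := by
  set s := μ.toSignedMeasure - ν.toSignedMeasure with hs
  have hfin : IsFiniteMeasure s.totalVariation := by
    unfold SignedMeasure.totalVariation; infer_instance
  refine ⟨s.totalVariation, hfin, le_rfl, Measure.le_iff.2 fun A hA => ?_⟩
  have h1 := s.apply_eq_posPart_real_sub_negPart_real hA
  have h2 : s A = μ.real A - ν.real A := by
    rw [hs, Measure.toSignedMeasure_sub_apply hA]
  have h3 : s.toJordanDecomposition.posPart.real A ≤ s.totalVariation.real A := by
    simp only [SignedMeasure.totalVariation]
    rw [measureReal_add_apply]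
    linarith [measureReal_nonneg (μ := s.toJordanDecomposition.negPart) (s := A)]
  have h4 : μ.real A ≤ (ν + s.totalVariation).real A := by
    rw [measureReal_add_apply]
    linarith [measureReal_nonneg (μ := s.toJordanDecomposition.negPart) (s := A)]
  exact (ENNReal.toReal_le_toReal (measure_ne_top _ _) (measure_ne_top _ _)).1 h4

/-- For equal total masses a one-sided bound is two-sided. On a Hahn decomposition the positive and
the negative part of `μ - ν` both have mass `μ Sᶜ - ν Sᶜ`, hence the factor 2. -/
theorem ExcessLE.tvNorm_le {μ ν : Measure E} [IsProbabilityMeasure μ] [IsProbabilityMeasure ν]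
    {ε : ℝ≥0∞} (h : ExcessLE μ ν ε) : tvNorm μ ν ≤ 2 * ε := by
  set s := μ.toSignedMeasure - ν.toSignedMeasure with hs
  obtain ⟨S, hS, -, -, hp, hn⟩ := s.toJordanDecomposition.exists_compl_positive_negative
  have hsA : ∀ A, MeasurableSet A → s.toJordanDecomposition.posPart.real A
      - s.toJordanDecomposition.negPart.real A = μ.real A - ν.real A := fun A hA => by
    rw [← s.apply_eq_posPart_real_sub_negPart_real hA, hs, Measure.toSignedMeasure_sub_apply hA]
  have hpr : s.toJordanDecomposition.posPart.real S = 0 := by simp [measureReal_def, hp]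
  have hnr : s.toJordanDecomposition.negPart.real Sᶜ = 0 := by simp [measureReal_def, hn]
  have h1 := hsA S hS
  have h2 := hsA Sᶜ hS.compl
  have hle : μ.real Sᶜ - ν.real Sᶜ = (μ Sᶜ - ν Sᶜ).toReal ∨ μ.real Sᶜ - ν.real Sᶜ ≤ 0 := by
    rcases le_total (ν Sᶜ) (μ Sᶜ) with h | h
    · left; rw [ENNReal.toReal_sub_of_le h (measure_ne_top _ _)]; rfl
    · right
      have : μ.real Sᶜ ≤ ν.real Sᶜ := ENNReal.toReal_mono (measure_ne_top _ _) h
      linarith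
  have hb : ENNReal.ofReal (μ.real Sᶜ - ν.real Sᶜ) ≤ ε := by
    rcases hle with h' | h'
    · rw [h']
      refine ENNReal.ofReal_toReal_le.trans ?_
      rw [tsub_le_iff_left]
      exact h.apply_le _
    · rw [ENNReal.ofReal_of_nonpos h']; exact zero_le
  have hcompl : μ.real S - ν.real S = -(μ.real Sᶜ - ν.real Sᶜ) := by
    have a := probReal_compl_eq_one_sub (μ := μ) hS
    have b := probReal_compl_eq_one_sub (μ := ν) hS
    linarith
  have hP : s.toJordanDecomposition.posPart Set.univ = ENNReal.ofReal (μ.real Sᶜ - ν.real Sᶜ) := by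
    rw [← measure_add_measure_compl hS, hp, zero_add, ← h2, hnr, sub_zero, ofReal_measureReal]
  have hN : s.toJordanDecomposition.negPart Set.univ = ENNReal.ofReal (μ.real Sᶜ - ν.real Sᶜ) := by
    rw [← measure_add_measure_compl hS, hn, add_zero, ← neg_neg (μ.real Sᶜ - ν.real Sᶜ),
      ← hcompl, ← h1, hpr, zero_sub, neg_neg, ofReal_measureReal]
  unfold tvNorm
  rw [← hs, SignedMeasure.totalVariation, Measure.add_apply, hP, hN, two_mul]
  exact add_le_add hb hb

theorem tendsto_apply_of_tvNorm {μ : ℕ → Measure E} {ν : Measure E}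
    [∀ k, IsFiniteMeasure (μ k)] [IsFiniteMeasure ν]
    (h : Tendsto (fun k => tvNorm (μ k) ν) atTop (𝓝 0)) (A : Set E) :
    Tendsto (fun k => μ k A) atTop (𝓝 (ν A)) := by
  refine tendsto_of_tendsto_of_tendsto_of_le_of_le
    (g := fun k => ν A - tvNorm (μ k) ν) (h := fun k => ν A + tvNorm (μ k) ν) ?_ ?_ ?_ ?_
  · simpa using ENNReal.Tendsto.sub (tendsto_const_nhds (x := ν A)) h (Or.inl (measure_ne_top _ _))
  · simpa using (tendsto_const_nhds (x := ν A)).add h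
  · intro k
    simp only [tsub_le_iff_right]
    rw [tvNorm_comm]
    exact (excessLE_tvNorm ν (μ k)).apply_le A
  · intro k
    exact (excessLE_tvNorm (μ k) ν).apply_le A

theorem ExcessLE.map {μ ν : Measure E} {ε : ℝ≥0∞} (h : ExcessLE μ ν ε) {f : E → F}
    (hf : Measurable f) : ExcessLE (μ.map f) (ν.map f) ε := by
  obtain ⟨ρ, hρ, hε, hle⟩ := h
  refine ⟨ρ.map f, inferInstance, ?_, ?_⟩
  · rwa [Measure.map_apply hf MeasurableSet.univ, Set.preimage_univ]
  · rw [← Measure.map_add _ _ hf]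
    exact Measure.map_mono hle hf

theorem ExcessLE.bind {μ ν : Measure E} {ε : ℝ≥0∞} (h : ExcessLE μ ν ε) (κ : Kernel E F)
    [IsMarkovKernel κ] : ExcessLE (μ.bind κ) (ν.bind κ) ε := by
  obtain ⟨ρ, hρ, hε, hle⟩ := h
  refine ⟨ρ.bind κ, inferInstance, ?_, Measure.le_iff.2 fun A hA => ?_⟩
  · rw [Measure.bind_apply MeasurableSet.univ κ.aemeasurable]
    simpa using hε
  · rw [Measure.add_apply, Measure.bind_apply hA κ.aemeasurable,
      Measure.bind_apply hA κ.aemeasurable, Measure.bind_apply hA κ.aemeasurable,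
      ← lintegral_add_measure]
    exact lintegral_mono' hle le_rfl

theorem ExcessLE.prod {μ ν : Measure E} {μ' ν' : Measure F} {ε ε' : ℝ≥0∞}
    [IsProbabilityMeasure μ'] [IsProbabilityMeasure ν]
    [IsProbabilityMeasure ν'] (h : ExcessLE μ ν ε) (h' : ExcessLE μ' ν' ε') :
    ExcessLE (μ.prod μ') (ν.prod ν') (ε + ε') := by
  obtain ⟨ρ, hρ, hε, hle⟩ := h
  obtain ⟨ρ', hρ', hε', hle'⟩ := h'
  -- Replace one factor at a time: `μ ⊗ μ' ≤ ν ⊗ μ' + ρ ⊗ μ'`, then `ν ⊗ μ' ≤ ν ⊗ ν' + ν ⊗ ρ'`.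
  refine ⟨ρ.prod μ' + ν.prod ρ', inferInstance, ?_, ?_⟩
  · rw [Measure.add_apply, ← Set.univ_prod_univ, Measure.prod_prod, Measure.prod_prod]
    simpa using add_le_add hε hε'
  · calc μ.prod μ' ≤ (ν + ρ).prod μ' := Measure.prod_mono hle le_rfl
      _ = ν.prod μ' + ρ.prod μ' := Measure.add_prod _
      _ ≤ ν.prod (ν' + ρ') + ρ.prod μ' := by
        gcongr
      _ = ν.prod ν' + (ρ.prod μ' + ν.prod ρ') := by
        rw [Measure.prod_add]; abel

theorem ExcessLE.pi {n : ℕ} {E : Fin n → Type*} [∀ i, MeasurableSpace (E i)]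
    {μ ν : ∀ i, Measure (E i)} [∀ i, IsProbabilityMeasure (μ i)] [∀ i, IsProbabilityMeasure (ν i)]
    {ε : Fin n → ℝ≥0∞} (h : ∀ i, ExcessLE (μ i) (ν i) (ε i)) :
    ExcessLE (Measure.pi μ) (Measure.pi ν) (∑ i, ε i) := by
  induction n with
  | zero =>
    refine ⟨0, inferInstance, by simp, ?_⟩
    rw [Measure.pi_of_empty μ, Measure.pi_of_empty ν]
    simp
  | succ n ih =>
    rw [← ((measurePreserving_piFinSuccAbove μ 0).symm).map_eq,
      ← ((measurePreserving_piFinSuccAbove ν 0).symm).map_eq, Fin.sum_univ_succ]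
    refine ExcessLE.map (ExcessLE.prod (h 0) (ih fun i => h _)) (MeasurableEquiv.measurable _)

end TV

variable {d : ℕ}

/-! ### Elementary properties of the flow and of the clocks -/

@[simp] theorem flow_zero (x : State d) : flow x 0 = x := by simp [flow]

theorem flow_add (x : State d) (s t : ℝ) : flow x (s + t) = flow (flow x s) t := by
  ext i <;> simp [flow, mul_add, add_assoc]

theorem continuous_flow_right (x : State d) : Continuous fun s : ℝ => flow x s :=
  continuous_flow.comp (by fun_prop : Continuous fun s : ℝ => (x, s))

theorem abs_sgn (u : ℤˣ) : |sgn u| = 1 := by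
  rcases Int.units_eq_one_or u with rfl | rfl <;> simp [sgn]

theorem abs_flow_sub (x : State d) (i : Fin d) {s : ℝ} (hs : 0 ≤ s) :
    |(flow x s).1 i - x.1 i| = s := by
  simp [flow, abs_mul, abs_sgn, abs_of_nonneg hs]

theorem Rates.continuous_rate_flow_right (Λ : Rates d) (i : Fin d) (x : State d) :
    Continuous fun s : ℝ => Λ.rate i (flow x s) :=
  (Λ.continuous i).comp (continuous_flow_right x)

@[simp] theorem Rates.cumul_zero (Λ : Rates d) (i : Fin d) (x : State d) : Λ.cumul i x 0 = 0 := by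
  simp [Rates.cumul]

theorem Rates.hasDerivAt_cumul (Λ : Rates d) (i : Fin d) (x : State d) (t : ℝ) :
    HasDerivAt (Λ.cumul i x) (Λ.rate i (flow x t)) t :=
  (Λ.continuous_rate_flow_right i x).integral_hasStrictDerivAt 0 t |>.hasDerivAt

theorem Rates.continuous_cumul_right (Λ : Rates d) (i : Fin d) (x : State d) :
    Continuous (Λ.cumul i x) :=
  continuous_iff_continuousAt.2 fun t => (Λ.hasDerivAt_cumul i x t).continuousAt

theorem Rates.cumul_nonneg (Λ : Rates d) (i : Fin d) (x : State d) {t : ℝ} (ht : 0 ≤ t) :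
    0 ≤ Λ.cumul i x t :=
  (Λ.cumul_zero i x).symm.le.trans (Λ.cumul_mono i x le_rfl ht)

theorem Rates.cumul_add (Λ : Rates d) (i : Fin d) (x : State d) (s t : ℝ) :
    Λ.cumul i x (s + t) = Λ.cumul i x s + Λ.cumul i (flow x s) t := by
  have hc := Λ.continuous_rate_flow_right i x
  unfold Rates.cumul
  simp_rw [← flow_add]
  rw [intervalIntegral.integral_comp_add_left (fun r => Λ.rate i (flow x r)), add_zero,
    intervalIntegral.integral_add_adjacent_intervals (hc.intervalIntegrable _ _)
      (hc.intervalIntegrable _ _)]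

/-- The infimum defining the clock is attained because the integrated rate is continuous: if it is
below `e` at `t`, it stays below `e` up to `t + ε / 2`. -/
theorem Rates.clock_le_iff (Λ : Rates d) (i : Fin d) (x : State d) (e : ℝ) (t : ℝ≥0) :
    Λ.clock i x e ≤ t ↔ e ≤ Λ.cumul i x t := by
  refine ⟨fun h => ?_, fun h => iInf₂_le t h⟩
  by_contra! hlt
  obtain ⟨ε, hε, hball⟩ := Metric.eventually_nhds_iff.1
    ((Λ.continuous_cumul_right i x).continuousAt.eventually_lt continuousAt_const hlt)
  have hε2 : (0 : ℝ) ≤ ε / 2 := by positivity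
  have hs : Λ.cumul i x (t + ε / 2) < e := hball (by simp [abs_of_pos hε]; linarith)
  have : ((t + ⟨ε / 2, hε2⟩ : ℝ≥0) : ℝ≥0∞) ≤ Λ.clock i x e := by
    refine le_iInf₂ fun r hr => ?_
    rw [ENNReal.coe_le_coe]
    by_contra! hlt'
    have : (r : ℝ) ≤ t + ε / 2 := by exact_mod_cast hlt'.le
    exact absurd (hr.trans (Λ.cumul_mono i x r.2 this)) (not_le.2 hs)
  have h2 := ENNReal.coe_le_coe.1 (this.trans h)
  have : (t : ℝ) + ε / 2 ≤ t := by exact_mod_cast h2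
  linarith

theorem Rates.lt_clock_iff (Λ : Rates d) (i : Fin d) (x : State d) (e : ℝ) (t : ℝ≥0) :
    t < Λ.clock i x e ↔ Λ.cumul i x t < e := by
  rw [← not_le, Λ.clock_le_iff, not_le]

theorem Rates.le_cumul_of_le_clock (Λ : Rates d) (i : Fin d) (x : State d) {e : ℝ} {t : ℝ≥0}
    (he : 0 ≤ e) (h : t ≤ Λ.clock i x e) : Λ.cumul i x t ≤ e := by
  -- At `t = 0` the bound on the clock says nothing, and only `0 ≤ e` helps.
  rcases eq_or_ne t 0 with rfl | ht
  · simpa using he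
  by_contra! hlt
  obtain ⟨ε, hε, hball⟩ := Metric.eventually_nhds_iff.1
    (continuousAt_const.eventually_lt (Λ.continuous_cumul_right i x).continuousAt hlt)
  have ht' : (0 : ℝ) < t := by positivity
  set r : ℝ := max (t - ε / 2) (t / 2) with hr
  have hr0 : 0 ≤ r := le_max_of_le_right (by positivity)
  have hrt : r < t := max_lt (by linarith) (by linarith)
  have hr2 : t - ε / 2 ≤ r := le_max_left _ _
  have : e < Λ.cumul i x r := hball (by
    rw [Real.dist_eq, abs_lt]; constructor <;> linarith)
  have h1 := (Λ.clock_le_iff i x e ⟨r, hr0⟩).2 this.le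
  have h2 : t ≤ (⟨r, hr0⟩ : ℝ≥0) := ENNReal.coe_le_coe.1 (h.trans h1)
  exact absurd (show (t : ℝ) ≤ r from h2) (not_le.2 hrt)

/-! ### The first switch -/

/-- The state after flipping the `i`-th velocity. -/
def flip (i : Fin d) (x : State d) : State d := (x.1, Function.update x.2 i (-x.2 i))

theorem measurable_flip (i : Fin d) : Measurable (flip i : State d → State d) := by
  refine measurable_fst.prodMk (measurable_pi_lambda _ fun j => ?_)
  rcases eq_or_ne j i with rfl | h
  · simp only [Function.update_self]
    exact (Measurable.of_discrete (f := fun u : ℤˣ => -u)).comp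
      ((measurable_pi_apply j).comp measurable_snd)
  · simp only [Function.update_of_ne h]
    exact (measurable_pi_apply j).comp measurable_snd

/-- The time of the first switch. -/
def Rates.first (Λ : Rates d) (x : State d) (e : Fin d → ℝ) : ℝ≥0∞ := ⨅ i, Λ.clock i x (e i)

/-- The state just after the first switch. -/
def Rates.next (Λ : Rates d) (x : State d) (e : Fin d → ℝ) : State d := (Λ.step (0, x) e).2

theorem Rates.step_eq (Λ : Rates d) (T : ℝ≥0∞) (x : State d) (e : Fin d → ℝ) :
    Λ.step (T, x) e = (T + Λ.first x e, Λ.next x e) := rfl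

theorem IsArgmin.unique {τ : Fin d → ℝ≥0∞} {i j : Fin d} (hi : IsArgmin τ i) (hj : IsArgmin τ j) :
    i = j := by
  rcases lt_trichotomy i j with h | h | h
  · exact absurd (hj.2 i h) (not_lt.2 (hi.1 j))
  · exact h
  · exact absurd (hi.2 j h) (not_lt.2 (hj.1 i))

theorem exists_isArgmin [NeZero d] (τ : Fin d → ℝ≥0∞) : ∃ i, IsArgmin τ i := by
  classical
  obtain ⟨i₀, h₀⟩ := Finite.exists_min τ
  have hne : (Finset.univ.filter fun i => ∀ j, τ i ≤ τ j).Nonempty := ⟨i₀, by simpa using h₀⟩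
  refine ⟨_, (Finset.mem_filter.1 (Finset.min'_mem _ hne)).2, fun j hj => ?_⟩
  by_contra! hle
  have := Finset.min'_le (Finset.univ.filter fun i => ∀ j, τ i ≤ τ j) j (by
    simpa using fun k => hle.trans ((Finset.mem_filter.1 (Finset.min'_mem _ hne)).2 k))
  exact absurd hj (not_lt.2 this)

theorem Rates.first_eq_of_isArgmin (Λ : Rates d) {x : State d} {e : Fin d → ℝ} {i : Fin d}
    (h : IsArgmin (fun i => Λ.clock i x (e i)) i) : Λ.first x e = Λ.clock i x (e i) :=
  le_antisymm (iInf_le _ i) (le_iInf h.1)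

theorem Rates.next_eq_of_isArgmin (Λ : Rates d) {x : State d} {e : Fin d → ℝ} {i : Fin d}
    (h : IsArgmin (fun i => Λ.clock i x (e i)) i) :
    Λ.next x e = flip i (flow x (Λ.clock i x (e i)).toReal) := by
  rw [← Λ.first_eq_of_isArgmin h]
  refine Prod.ext rfl (funext fun j => ?_)
  simp only [Rates.next, Rates.step, flip]
  rcases eq_or_ne j i with rfl | hj
  · rw [if_pos h, Function.update_self]; rfl
  · rw [if_neg fun h' => hj (h'.unique h), Function.update_of_ne hj]; rfl

theorem Rates.measurable_first (Λ : Rates d) (x : State d) : Measurable (Λ.first x) :=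
  Measurable.iInf fun i => (Λ.measurable_clock i).comp
    (by fun_prop : Measurable fun e : Fin d → ℝ => (x, e i))

theorem Rates.next_fst (Λ : Rates d) (x : State d) (e : Fin d → ℝ) :
    (Λ.next x e).1 = (flow x (Λ.first x e).toReal).1 := rfl

/-! ### The skeleton chain -/

/-- The recursion appends steps at the end; the renewal argument needs the first step peeled off
instead. -/
theorem Rates.skeleton_succ' (Λ : Rates d) (x : State d) (ω : ℕ → Fin d → ℝ) (k : ℕ) :
    Λ.skeleton x ω (k + 1) =
      (Λ.first x (ω 0) + (Λ.skeleton (Λ.next x (ω 0)) (fun n => ω (n + 1)) k).1,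
        (Λ.skeleton (Λ.next x (ω 0)) (fun n => ω (n + 1)) k).2) := by
  induction k with
  | zero => simp [Rates.skeleton, Rates.step_eq]
  | succ k ih => rw [Rates.skeleton, ih, Rates.step_eq, add_assoc]; rfl

theorem Rates.skeleton_fst_succ (Λ : Rates d) (x : State d) (ω : ℕ → Fin d → ℝ) (k : ℕ) :
    (Λ.skeleton x ω (k + 1)).1 =
      (Λ.skeleton x ω k).1 + Λ.first (Λ.skeleton x ω k).2 (ω k) := rfl

theorem Rates.skeleton_snd_succ (Λ : Rates d) (x : State d) (ω : ℕ → Fin d → ℝ) (k : ℕ) :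
    (Λ.skeleton x ω (k + 1)).2 = Λ.next (Λ.skeleton x ω k).2 (ω k) := rfl

theorem Rates.skeleton_fst_mono (Λ : Rates d) (x : State d) (ω : ℕ → Fin d → ℝ) :
    Monotone fun k => (Λ.skeleton x ω k).1 :=
  monotone_nat_of_le_succ fun k => by rw [Λ.skeleton_fst_succ]; exact le_self_add

theorem Rates.abs_skeleton_sub_le (Λ : Rates d) (x : State d) (ω : ℕ → Fin d → ℝ) (k : ℕ)
    (h : (Λ.skeleton x ω k).1 ≠ ∞) (i : Fin d) :
    |(Λ.skeleton x ω k).2.1 i - x.1 i| ≤ (Λ.skeleton x ω k).1.toReal := by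
  induction k with
  | zero => simp [Rates.skeleton]
  | succ k ih =>
    rw [Λ.skeleton_fst_succ] at h ⊢
    have h1 := (ENNReal.add_ne_top.1 h).1
    have h2 := (ENNReal.add_ne_top.1 h).2
    rw [ENNReal.toReal_add h1 h2, Λ.skeleton_snd_succ, Λ.next_fst]
    have h3 := abs_flow_sub (Λ.skeleton x ω k).2 i
      (s := (Λ.first (Λ.skeleton x ω k).2 (ω k)).toReal) ENNReal.toReal_nonneg
    have h4 := abs_sub_le ((flow (Λ.skeleton x ω k).2
      (Λ.first (Λ.skeleton x ω k).2 (ω k)).toReal).1 i) ((Λ.skeleton x ω k).2.1 i) (x.1 i)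
    linarith [ih h1]

/-- The driving noises for which the skeleton chain does not explode. -/
def Regular (ω : ℕ → Fin d → ℝ) : Prop := ∀ n, ∃ k ≥ n, ∀ i, 1 ≤ ω k i

theorem Regular.shift {ω : ℕ → Fin d → ℝ} (h : Regular ω) : Regular fun n => ω (n + 1) := by
  intro n
  obtain ⟨k, hk, h'⟩ := h (n + 1)
  obtain ⟨m, rfl⟩ : ∃ m, k = m + 1 := ⟨k - 1, by omega⟩
  exact ⟨m, by omega, h'⟩

theorem Rates.exists_rate_bound (Λ : Rates d) (x : State d) (r : ℝ) :
    ∃ M : ℝ, 1 ≤ M ∧ ∀ y : State d, (∀ i, |y.1 i - x.1 i| ≤ r) → ∀ i, Λ.rate i y ≤ M := by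
  have hK : IsCompact ((Set.univ.pi fun i => Set.Icc (x.1 i - r) (x.1 i + r)) ×ˢ
      (Set.univ : Set (Fin d → ℤˣ))) :=
    (isCompact_univ_pi fun i => isCompact_Icc).prod isCompact_univ
  have hb : ∀ i, ∃ M, ∀ y ∈ ((Set.univ.pi fun i => Set.Icc (x.1 i - r) (x.1 i + r)) ×ˢ
      (Set.univ : Set (Fin d → ℤˣ))), ‖Λ.rate i y‖ ≤ M := fun i =>
    hK.exists_bound_of_continuousOn (Λ.continuous i).continuousOn
  choose M hM using hb
  refine ⟨1 + ∑ i, |M i|, by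
    linarith [Finset.sum_nonneg (s := Finset.univ) (f := fun i => |M i|) fun i _ => abs_nonneg (M i)], fun y hy i => ?_⟩
  have h1 : ‖Λ.rate i y‖ ≤ M i := hM i y ⟨fun j _ => by
    have := abs_le.1 (hy j); constructor <;> linarith, Set.mem_univ _⟩
  have h2 : |M i| ≤ ∑ i, |M i| :=
    Finset.single_le_sum (f := fun i => |M i|) (fun j _ => abs_nonneg _) (Finset.mem_univ i)
  linarith [le_abs_self (M i), Real.le_norm_self (Λ.rate i y)]

theorem Rates.cumul_le (Λ : Rates d) (i : Fin d) (x : State d) {M t : ℝ} (ht : 0 ≤ t)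
    (h : ∀ s ∈ Set.Icc 0 t, Λ.rate i (flow x s) ≤ M) : Λ.cumul i x t ≤ M * t := by
  have := intervalIntegral.integral_mono_on ht
    ((Λ.continuous_rate_flow_right i x).intervalIntegrable 0 t)
    (intervalIntegrable_const (μ := volume) (c := M)) h
  simpa [Rates.cumul, mul_comm] using this

/-- If the switching times stayed below `t`, unit speed would confine the skeleton to a compact box
on which the rates are bounded. Each of the infinitely many steps with all levels at least 1 would
then last at least a fixed time `c`. -/
theorem Regular.exists_lt {ω : ℕ → Fin d → ℝ} (h : Regular ω) (Λ : Rates d) (x : State d)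
    (t : ℝ≥0) : ∃ k, (t : ℝ≥0∞) < (Λ.skeleton x ω (k + 1)).1 := by
  by_contra! hle
  have hle' : ∀ k, (Λ.skeleton x ω k).1 ≤ t := fun k =>
    (Λ.skeleton_fst_mono x ω k.le_succ).trans (hle k)
  -- Radius `t` covers the skeleton points; the extra 1 covers a further stretch of length `c ≤ 1`.
  obtain ⟨M, hM1, hM⟩ := Λ.exists_rate_bound x (t + 1)
  have hM0 : 0 < M := by linarith
  set c : ℝ≥0 := ⟨M⁻¹ / 2, by positivity⟩ with hc
  have hc0 : (c : ℝ) = M⁻¹ / 2 := rfl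
  have hMc : M * c < 1 := by rw [hc0]; field_simp; norm_num
  have hc1 : (c : ℝ) ≤ 1 := by
    rw [hc0]; linarith [inv_le_one_of_one_le₀ hM1]
  have hstep : ∀ k, (∀ i, 1 ≤ ω k i) → (c : ℝ≥0∞) ≤ Λ.first (Λ.skeleton x ω k).2 (ω k) := by
    intro k hk
    refine le_iInf fun i => le_of_lt ((Λ.lt_clock_iff i _ _ c).2 (lt_of_le_of_lt ?_
      (hMc.trans_le (hk i))))
    refine Λ.cumul_le i _ c.2 fun s hs => hM _ (fun j => ?_) i
    have h1 := abs_flow_sub (Λ.skeleton x ω k).2 j hs.1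
    have h2 := Λ.abs_skeleton_sub_le x ω k ((hle' k).trans_lt ENNReal.coe_lt_top).ne j
    have h3 : (Λ.skeleton x ω k).1.toReal ≤ t := by
      simpa using ENNReal.toReal_mono ENNReal.coe_ne_top (hle' k)
    have h4 := abs_sub_le ((flow (Λ.skeleton x ω k).2 s).1 j) ((Λ.skeleton x ω k).2.1 j) (x.1 j)
    have h5 : s ≤ c := hs.2
    linarith
  have hgrow : ∀ n : ℕ, ∃ k, (n * c : ℝ≥0∞) ≤ (Λ.skeleton x ω k).1 := by
    intro n
    induction n with
    | zero => exact ⟨0, by simp⟩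
    | succ n ih =>
      obtain ⟨k, hk⟩ := ih
      obtain ⟨m, hm, hm'⟩ := h k
      refine ⟨m + 1, ?_⟩
      rw [Λ.skeleton_fst_succ, Nat.cast_add, Nat.cast_one, add_mul, one_mul]
      exact add_le_add (hk.trans (Λ.skeleton_fst_mono x ω hm)) (hstep m hm')
  have hcpos : 0 < (c : ℝ) := by rw [hc0]; positivity
  obtain ⟨n, hn⟩ := exists_nat_gt ((t : ℝ) / c)
  obtain ⟨k, hk⟩ := hgrow n
  have := hk.trans (hle' k)
  have h' : (n : ℝ) * c ≤ t := by exact_mod_cast this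
  rw [div_lt_iff₀ hcpos] at hn
  linarith

/-! ### Decomposition of the trajectory at the first switch -/

theorem Rates.path_of_lt_first (Λ : Rates d) (x : State d) (ω : ℕ → Fin d → ℝ) {t : ℝ≥0}
    (h : t < Λ.first x (ω 0)) : Λ.path x ω t = flow x t := by
  have h0 : Λ.numSwitches x ω t = 0 := by
    rw [Rates.numSwitches, Nat.sInf_eq_zero]
    left
    simpa [Rates.skeleton, Rates.step_eq] using h
  simp [Rates.path, h0, Rates.skeleton]

/-- Pathwise renewal: after its first switch the trajectory is one started afresh with shifted
noise. Regularity keeps `numSwitches` from taking its default value 0 on an empty set. -/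
theorem Rates.path_of_first_le (Λ : Rates d) (x : State d) {ω : ℕ → Fin d → ℝ} (hω : Regular ω)
    {t : ℝ≥0} (h : Λ.first x (ω 0) ≤ t) :
    Λ.path x ω t =
      Λ.path (Λ.next x (ω 0)) (fun n => ω (n + 1)) (t - (Λ.first x (ω 0)).toNNReal) := by
  have hfin : Λ.first x (ω 0) ≠ ∞ := (h.trans_lt ENNReal.coe_lt_top).ne
  lift Λ.first x (ω 0) to ℝ≥0 using hfin with τ hτ
  rw [ENNReal.toNNReal_coe]
  rw [ENNReal.coe_le_coe] at h
  set y := Λ.next x (ω 0)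
  set ω' : ℕ → Fin d → ℝ := fun n => ω (n + 1)
  have key : ∀ k, (Λ.skeleton x ω (k + 1)).1 = τ + (Λ.skeleton y ω' k).1 := fun k => by
    rw [Λ.skeleton_succ', ← hτ]
  have hiff : ∀ T : ℝ≥0∞, (t : ℝ≥0∞) < τ + T ↔ ((t - τ : ℝ≥0) : ℝ≥0∞) < T := fun T => by
    rw [ENNReal.coe_sub, ENNReal.sub_lt_iff_lt_left ENNReal.coe_ne_top (by exact_mod_cast h)]
  obtain ⟨k₀, hk₀⟩ := hω.shift.exists_lt Λ y (t - τ)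
  have hmem := Nat.sInf_mem (s := {k : ℕ | ((t - τ : ℝ≥0) : ℝ≥0∞) < (Λ.skeleton y ω' (k + 1)).1})
    ⟨k₀, hk₀⟩
  change ((t - τ : ℝ≥0) : ℝ≥0∞) < (Λ.skeleton y ω' (Λ.numSwitches y ω' (t - τ) + 1)).1 at hmem
  have hnum : Λ.numSwitches x ω t = Λ.numSwitches y ω' (t - τ) + 1 := by
    refine le_antisymm (Nat.sInf_le ?_) ?_
    · change (t : ℝ≥0∞) < (Λ.skeleton x ω (_ + 1 + 1)).1
      rwa [key, hiff]
    · have hm := Nat.sInf_mem (s := {k : ℕ | (t : ℝ≥0∞) < (Λ.skeleton x ω (k + 1)).1})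
        (hω.exists_lt Λ x t)
      change (t : ℝ≥0∞) < (Λ.skeleton x ω (Λ.numSwitches x ω t + 1)).1 at hm
      -- Zero switches by time `t` would mean `t < τ`, so the count is a successor.
      rcases hn : Λ.numSwitches x ω t with _ | n
      · rw [hn, key] at hm
        simp only [Rates.skeleton, add_zero, ENNReal.coe_lt_coe] at hm
        exact absurd h (not_le.2 hm)
      · rw [hn, key, hiff] at hm
        exact Nat.succ_le_succ (Nat.sInf_le hm)
  have hle : (Λ.skeleton y ω' (Λ.numSwitches y ω' (t - τ))).1 ≤ (t - τ : ℝ≥0) := by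
    rcases hn : Λ.numSwitches y ω' (t - τ) with _ | n
    · simp [Rates.skeleton]
    · by_contra! hlt
      have : Λ.numSwitches y ω' (t - τ) ≤ n := Nat.sInf_le hlt
      omega
  have hfin' := (hle.trans_lt ENNReal.coe_lt_top).ne
  have hsnd : (Λ.skeleton x ω (Λ.numSwitches y ω' (t - τ) + 1)).2 =
      (Λ.skeleton y ω' (Λ.numSwitches y ω' (t - τ))).2 := by rw [Λ.skeleton_succ']
  simp only [Rates.path]
  rw [hnum, key, hsnd, ENNReal.toReal_add ENNReal.coe_ne_top hfin', NNReal.coe_sub h]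
  congr 1
  simp only [ENNReal.coe_toReal]
  ring

/-! ### Joint measurability -/

theorem Rates.measurable_path_uncurry (Λ : Rates d) :
    Measurable fun p : ℝ≥0 × State d × (ℕ → Fin d → ℝ) => Λ.path p.2.1 p.2.2 p.1 := by
  have hS : ∀ k, Measurable fun p : ℝ≥0 × State d × (ℕ → Fin d → ℝ) =>
      Λ.skeleton p.2.1 p.2.2 k := fun k => (Λ.measurable_skeleton k).comp measurable_snd
  have hm : ∀ k : ℕ, MeasurableSet {p : ℝ≥0 × State d × (ℕ → Fin d → ℝ) |
      (p.1 : ℝ≥0∞) < (Λ.skeleton p.2.1 p.2.2 (k + 1)).1} := fun k =>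
    measurableSet_lt (by fun_prop) (hS (k + 1)).fst
  have hN : Measurable fun p : ℝ≥0 × State d × (ℕ → Fin d → ℝ) =>
      Λ.numSwitches p.2.1 p.2.2 p.1 := by
    refine measurable_of_Iic fun n => ?_
    have : (fun p : ℝ≥0 × State d × (ℕ → Fin d → ℝ) => Λ.numSwitches p.2.1 p.2.2 p.1) ⁻¹'
        Set.Iic n =
        (⋃ k : ℕ, ⋃ _ : k ≤ n, {p : ℝ≥0 × State d × (ℕ → Fin d → ℝ) |
          (p.1 : ℝ≥0∞) < (Λ.skeleton p.2.1 p.2.2 (k + 1)).1}) ∪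
        (⋃ k : ℕ, {p : ℝ≥0 × State d × (ℕ → Fin d → ℝ) |
          (p.1 : ℝ≥0∞) < (Λ.skeleton p.2.1 p.2.2 (k + 1)).1})ᶜ := by
      ext p
      simp only [Set.mem_preimage, Set.mem_Iic, Set.mem_union, Set.mem_iUnion, Set.mem_compl_iff,
        exists_prop, Rates.numSwitches, Set.mem_ofPred_eq]
      by_cases he : ∃ k : ℕ, (p.1 : ℝ≥0∞) < (Λ.skeleton p.2.1 p.2.2 (k + 1)).1
      · refine ⟨fun h => Or.inl ⟨_, h, Nat.sInf_mem (s := {k : ℕ |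
            (p.1 : ℝ≥0∞) < (Λ.skeleton p.2.1 p.2.2 (k + 1)).1}) he⟩, ?_⟩
        rintro (⟨k, hk, h⟩ | h)
        · exact (Nat.sInf_le h).trans hk
        · exact absurd he h
      · refine ⟨fun _ => Or.inr he, fun _ => ?_⟩
        have : {k : ℕ | (p.1 : ℝ≥0∞) < (Λ.skeleton p.2.1 p.2.2 (k + 1)).1} = ∅ :=
          Set.eq_empty_iff_forall_notMem.2 fun k hk => he ⟨k, hk⟩
        simp [this]
    rw [this]
    exact (MeasurableSet.iUnion fun k => MeasurableSet.iUnion fun _ => hm k).union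
      (MeasurableSet.iUnion hm).compl
  have hz : Measurable fun p : ℝ≥0 × State d × (ℕ → Fin d → ℝ) =>
      Λ.skeleton p.2.1 p.2.2 (Λ.numSwitches p.2.1 p.2.2 p.1) :=
    (measurable_from_prod_countable_right
      (f := fun q : ℕ × (ℝ≥0 × State d × (ℕ → Fin d → ℝ)) =>
        Λ.skeleton q.2.2.1 q.2.2.2 q.1) hS).comp (hN.prodMk measurable_id)
  exact measurable_flow.comp (hz.snd.prodMk
    (measurable_fst.coe_nnreal_real.sub hz.fst.ennreal_toReal))

/-! ### The exponential law -/

theorem expMeasure_Iic {c : ℝ} (hc : 0 ≤ c) :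
    expMeasure 1 (Set.Iic c) = ENNReal.ofReal (1 - Real.exp (-c)) := by
  rw [← ofReal_measureReal, ← cdf_eq_real, cdf_expMeasure_eq one_pos, if_pos hc, one_mul]

theorem expMeasure_Ioi {c : ℝ} (hc : 0 ≤ c) :
    expMeasure 1 (Set.Ioi c) = ENNReal.ofReal (Real.exp (-c)) := by
  rw [← Set.compl_Iic, ← ofReal_measureReal, probReal_compl_eq_one_sub measurableSet_Iic,
    ← cdf_eq_real, cdf_expMeasure_eq one_pos, if_pos hc, one_mul, sub_sub_cancel]

instance : NullSingletonClass (expMeasure 1) := by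
  unfold expMeasure gammaMeasure; infer_instance

theorem expMeasure_Iio_zero : expMeasure 1 (Set.Iio 0) = 0 := by
  rw [measure_congr Iio_ae_eq_Iic, expMeasure_Iic le_rfl]; simp

theorem Rates.expMeasure_lt_clock (Λ : Rates d) (i : Fin d) (x : State d) (t : ℝ≥0) :
    expMeasure 1 {e | (t : ℝ≥0∞) < Λ.clock i x e} =
      ENNReal.ofReal (Real.exp (-Λ.cumul i x t)) := by
  rw [← expMeasure_Ioi (Λ.cumul_nonneg i x t.coe_nonneg)]
  congr 1
  ext e
  exact Λ.lt_clock_iff i x e t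

/-- Strict and weak inequality have the same probability, since the exponential law has no atoms. So
the tie-breaking rule in `IsArgmin` does not affect the law of the first switch. -/
theorem Rates.expMeasure_le_clock (Λ : Rates d) (i : Fin d) (x : State d) (t : ℝ≥0) :
    expMeasure 1 {e | (t : ℝ≥0∞) ≤ Λ.clock i x e} =
      ENNReal.ofReal (Real.exp (-Λ.cumul i x t)) := by
  refine le_antisymm ?_ ?_
  · rw [← expMeasure_Ioi (Λ.cumul_nonneg i x t.coe_nonneg), measure_congr Ioi_ae_eq_Ici]
    calc expMeasure 1 {e | (t : ℝ≥0∞) ≤ Λ.clock i x e}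
        ≤ expMeasure 1 (Set.Iio 0 ∪ Set.Ici (Λ.cumul i x t)) := by
          refine measure_mono fun e he => ?_
          rcases lt_or_ge e 0 with h | h
          · exact Or.inl h
          · exact Or.inr (Λ.le_cumul_of_le_clock i x h he)
      _ ≤ _ := (measure_union_le _ _).trans (by rw [expMeasure_Iio_zero, zero_add])
  · rw [← Λ.expMeasure_lt_clock]
    exact measure_mono fun e (he : (t : ℝ≥0∞) < Λ.clock i x e) => he.le

theorem Rates.measurable_clock_right (Λ : Rates d) (i : Fin d) (x : State d) :
    Measurable (Λ.clock i x) :=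
  (Λ.measurable_clock i).comp measurable_prodMk_left

theorem Rates.lintegral_hazard (Λ : Rates d) (i : Fin d) (x : State d) {t : ℝ} (ht : 0 ≤ t) :
    ∫⁻ s in Set.Ioc 0 t, ENNReal.ofReal (Λ.rate i (flow x s) * Real.exp (-Λ.cumul i x s)) =
      ENNReal.ofReal (1 - Real.exp (-Λ.cumul i x t)) := by
  have hc : Continuous fun s => Λ.rate i (flow x s) * Real.exp (-Λ.cumul i x s) :=
    (Λ.continuous_rate_flow_right i x).mul
      (Real.continuous_exp.comp (Λ.continuous_cumul_right i x).neg)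
  rw [← ofReal_integral_eq_lintegral_ofReal (hc.integrableOn_Ioc)
    (Eventually.of_forall fun s => mul_nonneg (Λ.nonneg i _) (Real.exp_pos _).le),
    ← intervalIntegral.integral_of_le ht]
  congr 1
  rw [intervalIntegral.integral_eq_sub_of_hasDerivAt (f := fun s => -Real.exp (-Λ.cumul i x s))
    (fun s _ => ?_) (hc.intervalIntegrable _ _)]
  · simp; ring
  · exact ((Λ.hasDerivAt_cumul i x s).neg.exp.neg).congr_deriv (by simp [mul_comm])

/-- The clock has density `λ_i exp (-∫ λ_i)` on finite times, as is checked on half-lines.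
Restricting to `{clock ≤ t}` removes the value `∞`, which `toReal` would send to 0. -/
theorem Rates.lintegral_clock (Λ : Rates d) (i : Fin d) (x : State d) (t : ℝ≥0)
    {g : ℝ → ℝ≥0∞} (hg : Measurable g) :
    ∫⁻ e in {e | Λ.clock i x e ≤ t}, g (Λ.clock i x e).toReal ∂(expMeasure 1) =
      ∫⁻ s in Set.Ioc 0 (t : ℝ),
        ENNReal.ofReal (Λ.rate i (flow x s) * Real.exp (-Λ.cumul i x s)) * g s := by
  have hc : Continuous fun s => Λ.rate i (flow x s) * Real.exp (-Λ.cumul i x s) :=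
    (Λ.continuous_rate_flow_right i x).mul
      (Real.continuous_exp.comp (Λ.continuous_cumul_right i x).neg)
  have hm : Measurable fun e => (Λ.clock i x e).toReal :=
    (Λ.measurable_clock_right i x).ennreal_toReal
  have key : ((expMeasure 1).restrict {e | Λ.clock i x e ≤ t}).map
      (fun e => (Λ.clock i x e).toReal) = (volume.restrict (Set.Ioc 0 (t : ℝ))).withDensity
        fun s => ENNReal.ofReal (Λ.rate i (flow x s) * Real.exp (-Λ.cumul i x s)) := by
    refine Measure.ext_of_Iic _ _ fun a => ?_
    rw [Measure.map_apply hm measurableSet_Iic, Measure.restrict_apply (hm measurableSet_Iic),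
      withDensity_apply _ measurableSet_Iic, Measure.restrict_restrict measurableSet_Iic,
      Set.inter_comm (Set.Iic a), Set.Ioc_inter_Iic]
    rcases lt_or_ge a 0 with ha | ha
    · rw [Set.Ioc_eq_empty (by simp [ha.le]), Measure.restrict_empty, lintegral_zero_measure]
      refine measure_mono_null (t := ∅) (fun e he => ?_) measure_empty
      exact absurd (ENNReal.toReal_nonneg.trans he.1) (not_le.2 ha)
    · lift a to ℝ≥0 using ha
      rw [← NNReal.coe_min, Λ.lintegral_hazard i x (min t a).coe_nonneg,
        ← expMeasure_Iic (Λ.cumul_nonneg i x (min t a).coe_nonneg)]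
      congr 1
      ext e
      rw [Set.mem_Iic, ← Λ.clock_le_iff, ENNReal.coe_min, le_min_iff]
      simp only [Set.mem_inter_iff, Set.mem_preimage, Set.mem_Iic, Set.mem_ofPred_eq]
      rw [and_comm]
      refine and_congr_right fun h => ?_
      have hf : Λ.clock i x e ≠ ∞ := (h.trans_lt ENNReal.coe_lt_top).ne
      lift Λ.clock i x e to ℝ≥0 using hf with τ
      simp
  rw [← lintegral_map hg hm, key, lintegral_withDensity_eq_lintegral_mul _
    (hc.measurable.ennreal_ofReal) hg]
  rfl

/-! ### The law of the first switch -/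

/-- The total integrated rate `∑_i ∫_0^t λ_i(ξ + θ s, θ) ds`. -/
def Rates.total (Λ : Rates d) (x : State d) (t : ℝ) : ℝ := ∑ i, Λ.cumul i x t

theorem Rates.pi_lt_first (Λ : Rates d) (x : State d) (t : ℝ≥0) :
    (Measure.pi fun _ : Fin d => expMeasure 1) {e | (t : ℝ≥0∞) < Λ.first x e} =
      ENNReal.ofReal (Real.exp (-Λ.total x t)) := by
  have : {e | (t : ℝ≥0∞) < Λ.first x e} =
      Set.univ.pi fun i => {a | (t : ℝ≥0∞) < Λ.clock i x a} := by
    ext e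
    rw [Set.mem_univ_pi]
    refine ⟨fun h i => lt_of_lt_of_le (b := Λ.first x e) h
      (iInf_le (fun i => Λ.clock i x (e i)) i), fun h => ?_⟩
    rcases d with _ | n
    · exact lt_of_lt_of_eq ENNReal.coe_lt_top (iInf_of_empty fun i => Λ.clock i x (e i)).symm
    · obtain ⟨i, hi⟩ := Finite.exists_min fun i => Λ.clock i x (e i)
      exact (h i).trans_le (le_iInf hi)
  rw [this, Measure.pi_pi]
  simp_rw [Λ.expMeasure_lt_clock]
  rw [← ENNReal.ofReal_prod_of_nonneg fun i _ => (Real.exp_pos _).le, ← Real.exp_sum,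
    Finset.sum_neg_distrib, Rates.total]

/-- Condition on the `i`-th level. If clock `i` rings at `s`, the other independent clocks come no
earlier with probability `∏ exp (-cumul j s)`, which turns the density of clock `i` into `λ_i exp
(-total)`. -/
theorem Rates.lintegral_isArgmin (Λ : Rates d) (i : Fin d) (x : State d) (t : ℝ≥0)
    {g : ℝ → ℝ≥0∞} (hg : Measurable g) :
    ∫⁻ e in {e : Fin d → ℝ | IsArgmin (fun j => Λ.clock j x (e j)) i ∧ Λ.clock i x (e i) ≤ t},
        g (Λ.clock i x (e i)).toReal ∂(Measure.pi fun _ : Fin d => expMeasure 1) =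
      ∫⁻ s in Set.Ioc 0 (t : ℝ),
        ENNReal.ofReal (Λ.rate i (flow x s) * Real.exp (-Λ.total x s)) * g s := by
  rcases d with _ | n
  · exact i.elim0
  have hclock : ∀ j, Measurable fun e : Fin (n + 1) → ℝ => Λ.clock j x (e j) := fun j =>
    (Λ.measurable_clock_right j x).comp (measurable_pi_apply j)
  have hset : MeasurableSet {e : Fin (n + 1) → ℝ |
      IsArgmin (fun j => Λ.clock j x (e j)) i ∧ Λ.clock i x (e i) ≤ t} := by
    simp only [IsArgmin, Set.ofPred_and, Set.ofPred_forall]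
    exact ((MeasurableSet.iInter fun j => measurableSet_le (hclock i) (hclock j)).inter
      (MeasurableSet.iInter fun j => MeasurableSet.iInter fun _ =>
        measurableSet_lt (hclock i) (hclock j))).inter
          (measurableSet_le (hclock i) measurable_const)
  have hgm : Measurable fun e : Fin (n + 1) → ℝ => g (Λ.clock i x (e i)).toReal :=
    hg.comp (hclock i).ennreal_toReal
  rw [← lintegral_indicator hset,
    ← ((measurePreserving_piFinSuccAbove (fun _ : Fin (n + 1) => expMeasure 1) i).symm).lintegral_comp
      (hgm.indicator hset), lintegral_prod (fun z => Set.indicator {e : Fin (n + 1) → ℝ |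
      IsArgmin (fun j => Λ.clock j x (e j)) i ∧ Λ.clock i x (e i) ≤ t}
      (fun e => g (Λ.clock i x (e i)).toReal)
        ((MeasurableEquiv.piFinSuccAbove (fun _ => ℝ) i).symm z)) (((hgm.indicator hset).comp
        (MeasurableEquiv.measurable _)).aemeasurable)]
  have inner : ∀ a : ℝ, (∫⁻ b : Fin n → ℝ, Set.indicator {e : Fin (n + 1) → ℝ |
      IsArgmin (fun j => Λ.clock j x (e j)) i ∧ Λ.clock i x (e i) ≤ t}
      (fun e => g (Λ.clock i x (e i)).toReal)
        ((MeasurableEquiv.piFinSuccAbove (fun _ => ℝ) i).symm (a, b))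
        ∂(Measure.pi fun _ : Fin n => expMeasure 1)) =
      Set.indicator {a | Λ.clock i x a ≤ t} (fun a =>
        (∏ k, ENNReal.ofReal (Real.exp (-Λ.cumul (i.succAbove k) x (Λ.clock i x a).toReal))) *
          g (Λ.clock i x a).toReal) a := by
    intro a
    have hsame : ∀ b : Fin n → ℝ,
        (MeasurableEquiv.piFinSuccAbove (fun _ => ℝ) i).symm (a, b) i = a := fun b => by
      simp [MeasurableEquiv.piFinSuccAbove_symm_apply, Fin.insertNthEquiv_apply]
    by_cases ha : Λ.clock i x a ≤ t
    swap
    · rw [Set.indicator_of_notMem (by simpa using ha)]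
      refine (lintegral_congr fun b => Set.indicator_of_notMem ?_ _).trans lintegral_zero
      exact fun h => ha (hsame b ▸ h.2)
    have hf : Λ.clock i x a ≠ ∞ := (ha.trans_lt ENNReal.coe_lt_top).ne
    obtain ⟨s, hs⟩ : ∃ s : ℝ≥0, Λ.clock i x a = s := ⟨_, (ENNReal.coe_toNNReal hf).symm⟩
    rw [Set.indicator_of_mem (by exact ha), hs, ENNReal.coe_toReal]
    -- `i` is the first minimizer: indices before it must be strictly later, indices after it may
    -- tie.
    set B : Set (Fin n → ℝ) := Set.univ.pi fun k => if i.succAbove k < i then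
      {c | (s : ℝ≥0∞) < Λ.clock (i.succAbove k) x c} else
      {c | (s : ℝ≥0∞) ≤ Λ.clock (i.succAbove k) x c} with hB
    have hBm : MeasurableSet B := by
      refine MeasurableSet.univ_pi fun k => ?_
      split_ifs
      · exact measurableSet_lt measurable_const (Λ.measurable_clock_right _ x)
      · exact measurableSet_le measurable_const (Λ.measurable_clock_right _ x)
    have hind : ∀ b : Fin n → ℝ, Set.indicator {e : Fin (n + 1) → ℝ |
      IsArgmin (fun j => Λ.clock j x (e j)) i ∧ Λ.clock i x (e i) ≤ t}
      (fun e => g (Λ.clock i x (e i)).toReal)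
        ((MeasurableEquiv.piFinSuccAbove (fun _ => ℝ) i).symm (a, b)) =
        B.indicator (fun _ => g s) b := by
      intro b
      have hmem : (MeasurableEquiv.piFinSuccAbove (fun _ => ℝ) i).symm (a, b) ∈
          {e : Fin (n + 1) → ℝ | IsArgmin (fun j => Λ.clock j x (e j)) i ∧
            Λ.clock i x (e i) ≤ t} ↔ b ∈ B := by
        simp only [MeasurableEquiv.piFinSuccAbove_symm_apply, Fin.insertNthEquiv_apply,
          Set.mem_ofPred_eq, Fin.insertNth_apply_same, IsArgmin, hB, Set.mem_pi, Set.mem_univ,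
          true_imp_iff]
        rw [and_iff_left ha, Fin.forall_iff_succAbove i, Fin.forall_iff_succAbove i]
        simp only [Fin.insertNth_apply_same, Fin.insertNth_apply_succAbove, le_refl, true_and,
          lt_irrefl, false_imp_iff, hs]
        rw [← forall_and]
        refine forall_congr' fun k => ?_
        split_ifs with h
        · exact ⟨fun h' => h'.2 h, fun h' => ⟨le_of_lt h', fun _ => h'⟩⟩
        · exact ⟨fun h' => h'.1, fun h' => ⟨h', fun h'' => absurd h'' h⟩⟩
      by_cases hb : b ∈ B
      · rw [Set.indicator_of_mem (hmem.2 hb), Set.indicator_of_mem hb]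
        rw [hsame, hs, ENNReal.coe_toReal]
      · rw [Set.indicator_of_notMem (fun h => hb (hmem.1 h)), Set.indicator_of_notMem hb]
    simp_rw [hind]
    rw [lintegral_indicator_const hBm, mul_comm, hB, Measure.pi_pi]
    congr 1
    refine Finset.prod_congr rfl fun k _ => ?_
    split_ifs
    · exact Λ.expMeasure_lt_clock _ x s
    · exact Λ.expMeasure_le_clock _ x s
  refine (lintegral_congr inner).trans ?_
  rw [lintegral_indicator (measurableSet_le (Λ.measurable_clock_right i x) measurable_const)]
  have hgm' : Measurable fun s : ℝ =>
      (∏ k, ENNReal.ofReal (Real.exp (-Λ.cumul (i.succAbove k) x s))) * g s :=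
    (Finset.measurable_prod _ fun k _ => (Real.continuous_exp.comp
      (Λ.continuous_cumul_right _ x).neg).measurable.ennreal_ofReal).mul hg
  rw [Λ.lintegral_clock i x t hgm']
  refine lintegral_congr fun s => ?_
  rw [← mul_assoc]
  congr 1
  rw [← ENNReal.ofReal_prod_of_nonneg fun i _ => (Real.exp_pos _).le,
    ← ENNReal.ofReal_mul (mul_nonneg (Λ.nonneg i _) (Real.exp_pos _).le), ← Real.exp_sum,
    mul_assoc, ← Real.exp_add, Rates.total, Fin.sum_univ_succAbove _ i, Finset.sum_neg_distrib,
    neg_add]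

/-! ### Splitting off the first noise variable -/

/-- The sequence with first term `p.1` and remaining terms `p.2`. -/
def cons (p : (Fin d → ℝ) × (ℕ → Fin d → ℝ)) : ℕ → Fin d → ℝ
  | 0 => p.1
  | n + 1 => p.2 n

theorem measurable_cons : Measurable (cons (d := d)) := by
  refine measurable_pi_lambda _ fun n => ?_
  cases n with
  | zero => exact measurable_fst
  | succ n => exact (measurable_pi_apply n).comp measurable_snd

/-- The noise is i.i.d. in the step index, so its first term is independent of a tail with the same
law. Cylinder sets suffice to check this. -/
theorem map_cons_noise :
    ((Measure.pi fun _ : Fin d => expMeasure 1).prod (noise d)).map cons = noise d := by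
  classical
  refine Measure.eq_infinitePi _ fun s t ht => ?_
  obtain ⟨N, hN⟩ : ∃ N, s ⊆ Finset.range (N + 1) :=
    ⟨s.sup id, fun i hi => Finset.mem_range_succ_iff.2 (Finset.le_sup (f := id) hi)⟩
  -- Padding by `univ` makes the constrained indices an initial segment, from which index 0 splits
  -- off.
  set t' : ℕ → Set (Fin d → ℝ) := fun i => if i ∈ s then t i else Set.univ with ht'
  have htm : ∀ i, MeasurableSet (t' i) := fun i => by
    simp only [ht']; split_ifs
    exacts [ht i, MeasurableSet.univ]
  have hset : cons ⁻¹' Set.pi s t = t' 0 ×ˢ Set.pi (Finset.range N : Finset ℕ) (fun n => t' (n + 1)) := by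
    ext p
    have h1 : p ∈ cons ⁻¹' Set.pi s t ↔ ∀ i, i ∈ s → cons p i ∈ t i := Iff.rfl
    rw [h1, Set.mem_prod]
    constructor
    · intro h
      refine ⟨?_, fun n _ => ?_⟩
      · by_cases h0 : 0 ∈ s <;> simp only [ht', h0, if_true, if_false, Set.mem_univ]
        exact h 0 h0
      · by_cases h0 : n + 1 ∈ s <;> simp only [ht', h0, if_true, if_false, Set.mem_univ]
        exact h (n + 1) h0
    · rintro ⟨h0, hs⟩ i hi
      cases i with
      | zero =>
        simp only [ht', hi, if_true] at h0
        exact h0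
      | succ n =>
        have := hs n (by have := Finset.mem_range.1 (hN hi); simp; omega)
        simp only [ht', hi, if_true] at this
        exact this
  rw [Measure.map_apply measurable_cons (MeasurableSet.pi s.countable_toSet fun i _ => ht i), hset,
    Measure.prod_prod, noise, Measure.infinitePi_pi _ fun i _ => htm _]
  have hprod : ∏ i ∈ s, (Measure.pi fun _ : Fin d => expMeasure 1) (t i) =
      ∏ i ∈ Finset.range (N + 1), (Measure.pi fun _ : Fin d => expMeasure 1) (t' i) := by
    rw [← Finset.prod_subset hN fun i _ hi => by simp [ht', hi]]
    exact Finset.prod_congr rfl fun i hi => by simp [ht', hi]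
  rw [hprod, Finset.prod_range_succ', mul_comm]

theorem Regular.cons {ω : ℕ → Fin d → ℝ} (h : Regular ω) (e : Fin d → ℝ) :
    Regular (ZigZag.cons (e, ω)) := by
  intro n
  obtain ⟨k, hk, h'⟩ := h n
  exact ⟨k + 1, by omega, h'⟩

/-- All levels exceed 1 with positive probability at each step, so by independence failure at every
step from `n` on has probability at most `b ^ m` for all `m`, with `b < 1`. -/
theorem ae_regular : ∀ᵐ ω ∂(noise d), Regular ω := by
  set A : Set (Fin d → ℝ) := Set.univ.pi fun _ => Set.Ioi 1 with hA
  have hAm : MeasurableSet A := MeasurableSet.univ_pi fun _ => measurableSet_Ioi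
  have hb : (Measure.pi fun _ : Fin d => expMeasure 1) Aᶜ < 1 := by
    rw [prob_compl_eq_one_sub hAm]
    refine ENNReal.sub_lt_self ENNReal.one_ne_top one_ne_zero ?_
    rw [hA, Measure.pi_pi, expMeasure_Ioi zero_le_one]
    exact Finset.prod_ne_zero_iff.2 fun _ _ => by simp [Real.exp_pos]
  have hnull : ∀ n, noise d {ω | ∀ k ≥ n, ω k ∈ Aᶜ} = 0 := by
    intro n
    have hle : ∀ m, noise d {ω | ∀ k ≥ n, ω k ∈ Aᶜ} ≤
        ((Measure.pi fun _ : Fin d => expMeasure 1) Aᶜ) ^ m := by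
      intro m
      calc noise d {ω | ∀ k ≥ n, ω k ∈ Aᶜ}
          ≤ noise d (Set.pi (Finset.Ico n (n + m) : Finset ℕ) fun _ => Aᶜ) :=
            measure_mono fun ω hω k hk => hω k (Finset.mem_Ico.1 hk).1
        _ = _ := by
            rw [noise, Measure.infinitePi_pi _ fun _ _ => hAm.compl]
            simp
    exact le_antisymm (ge_of_tendsto' (ENNReal.tendsto_pow_atTop_nhds_zero_of_lt_one hb) hle)
      zero_le
  have : ∀ᵐ ω ∂(noise d), ∀ n, ¬ ∀ k ≥ n, ω k ∈ Aᶜ := by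
    rw [ae_all_iff]
    intro n
    rw [ae_iff]
    simpa using hnull n
  filter_upwards [this] with ω hω n
  obtain ⟨k, hk⟩ := not_forall.1 (hω n)
  rw [Classical.not_imp] at hk
  refine ⟨k, hk.1, fun i => ?_⟩
  have : ω k ∈ A := by simpa using hk.2
  exact le_of_lt (this i (Set.mem_univ i))

/-! ### The renewal equation -/

/-- `E f(Ξ(t), Θ(t))` for the process started at `x`. -/
def Rates.semigroup (Λ : Rates d) (f : State d → ℝ≥0∞) (t : ℝ≥0) (x : State d) : ℝ≥0∞ :=
  ∫⁻ y, f y ∂(Λ.transition t x)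

theorem Rates.semigroup_eq (Λ : Rates d) {f : State d → ℝ≥0∞} (hf : Measurable f) (t : ℝ≥0)
    (x : State d) : Λ.semigroup f t x = ∫⁻ ω, f (Λ.path x ω t) ∂(noise d) :=
  lintegral_map hf ((Λ.measurable_path t).comp measurable_prodMk_left)

theorem Rates.measurable_semigroup (Λ : Rates d) {f : State d → ℝ≥0∞} (hf : Measurable f) :
    Measurable fun p : ℝ≥0 × State d => Λ.semigroup f p.1 p.2 := by
  simp_rw [Λ.semigroup_eq hf]
  exact Measurable.lintegral_prod_right'
    (f := fun q : (ℝ≥0 × State d) × (ℕ → Fin d → ℝ) => f (Λ.path q.1.2 q.2 q.1.1))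
    (hf.comp (Λ.measurable_path_uncurry.comp (by fun_prop :
      Measurable fun q : (ℝ≥0 × State d) × (ℕ → Fin d → ℝ) => (q.1.1, q.1.2, q.2))))

theorem Rates.lintegral_path_cons (Λ : Rates d) {f : State d → ℝ≥0∞} (hf : Measurable f) (t : ℝ≥0)
    (x : State d) (e : Fin d → ℝ) :
    ∫⁻ ω, f (Λ.path x (cons (e, ω)) t) ∂(noise d) =
      Set.indicator {e | (t : ℝ≥0∞) < Λ.first x e} (fun _ => f (flow x t)) e +
      ∑ i, Set.indicator {e | IsArgmin (fun j => Λ.clock j x (e j)) i ∧ Λ.clock i x (e i) ≤ t}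
        (fun e => Λ.semigroup f (t - (Λ.clock i x (e i)).toReal.toNNReal)
          (flip i (flow x (Λ.clock i x (e i)).toReal))) e := by
  rcases lt_or_ge (t : ℝ≥0∞) (Λ.first x e) with h | h
  · have h1 : ∀ ω, Λ.path x (cons (e, ω)) t = flow x t := fun ω => Λ.path_of_lt_first x _ h
    simp_rw [h1]
    rw [Set.indicator_of_mem (by exact h), Finset.sum_eq_zero, lintegral_const, measure_univ,
      mul_one, add_zero]
    intro i _
    refine Set.indicator_of_notMem (fun h' => ?_) _
    exact absurd (h'.2.trans_lt (h.trans_le (iInf_le _ i))) (lt_irrefl _)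
  -- For `d = 0` the infimum over no clocks is `∞`, contradicting a first switch by time `t`.
  · have hd : NeZero d := ⟨by
      rintro rfl
      exact absurd ((iInf_of_empty fun i => Λ.clock i x (e i)).symm.le.trans h)
        (not_le.2 ENNReal.coe_lt_top)⟩
    obtain ⟨i, hi⟩ := exists_isArgmin fun j => Λ.clock j x (e j)
    have hc : Λ.clock i x (e i) ≤ t := (Λ.first_eq_of_isArgmin hi) ▸ h
    have hn : e ∉ {e | (t : ℝ≥0∞) < Λ.first x e} := fun h' => absurd h (not_le.2 h')
    rw [Set.indicator_of_notMem hn, zero_add, Finset.sum_eq_single i, Set.indicator_of_mem (by exact ⟨hi, hc⟩),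
      ← Λ.next_eq_of_isArgmin hi, ← Λ.first_eq_of_isArgmin hi, Λ.semigroup_eq hf]
    · refine lintegral_congr_ae ?_
      filter_upwards [ae_regular] with ω hω
      rw [Λ.path_of_first_le x (hω.cons e) h]
      rw [← ENNReal.toNNReal_toReal_eq]
      rfl
    · intro j _ hj
      exact Set.indicator_of_notMem (fun h' => hj (h'.1.unique hi)) _
    · simp

theorem Rates.semigroup_renewal (Λ : Rates d) {f : State d → ℝ≥0∞} (hf : Measurable f) (t : ℝ≥0)
    (x : State d) :
    Λ.semigroup f t x = ENNReal.ofReal (Real.exp (-Λ.total x t)) * f (flow x t) +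
      ∑ i, ∫⁻ s in Set.Ioc 0 (t : ℝ),
        ENNReal.ofReal (Λ.rate i (flow x s) * Real.exp (-Λ.total x s)) *
          Λ.semigroup f (t - s.toNNReal) (flip i (flow x s)) := by
  have hclock : ∀ j, Measurable fun e : Fin d → ℝ => Λ.clock j x (e j) := fun j =>
    (Λ.measurable_clock_right j x).comp (measurable_pi_apply j)
  have hset : ∀ i, MeasurableSet {e : Fin d → ℝ |
      IsArgmin (fun j => Λ.clock j x (e j)) i ∧ Λ.clock i x (e i) ≤ t} := by
    intro i
    simp only [IsArgmin, Set.ofPred_and, Set.ofPred_forall]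
    exact ((MeasurableSet.iInter fun j => measurableSet_le (hclock i) (hclock j)).inter
      (MeasurableSet.iInter fun j => MeasurableSet.iInter fun _ =>
        measurableSet_lt (hclock i) (hclock j))).inter
          (measurableSet_le (hclock i) measurable_const)
  have hp : ∀ i, Measurable fun s : ℝ => ((t - s.toNNReal, flip i (flow x s)) : ℝ≥0 × State d) :=
    fun i => Measurable.prodMk (by fun_prop)
      ((measurable_flip i).comp (continuous_flow_right x).measurable)
  have hg : ∀ i, Measurable fun s : ℝ =>
      Λ.semigroup f (t - s.toNNReal) (flip i (flow x s)) := fun i => by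
    have h := (Λ.measurable_semigroup hf).comp (hp i)
    simp only [Function.comp_def] at h
    exact h
  have hfirst : MeasurableSet {e | (t : ℝ≥0∞) < Λ.first x e} :=
    measurableSet_lt measurable_const (Λ.measurable_first x)
  have hpath : Measurable fun ω => f (Λ.path x ω t) :=
    hf.comp ((Λ.measurable_path t).comp measurable_prodMk_left)
  have hsplit : Λ.semigroup f t x = ∫⁻ e, ∫⁻ ω, f (Λ.path x (cons (e, ω)) t) ∂(noise d)
      ∂(Measure.pi fun _ : Fin d => expMeasure 1) := by
    rw [Λ.semigroup_eq hf, ← lintegral_prod (fun p => f (Λ.path x (cons p) t))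
      (hpath.comp measurable_cons).aemeasurable, ← lintegral_map hpath measurable_cons,
      map_cons_noise]
  rw [hsplit, lintegral_congr (Λ.lintegral_path_cons hf t x),
    lintegral_add_left (measurable_const.indicator hfirst),
    lintegral_indicator_const hfirst, Λ.pi_lt_first, mul_comm, lintegral_finsetSum']
  · congr 1
    refine Finset.sum_congr rfl fun i _ => ?_
    rw [lintegral_indicator (hset i), Λ.lintegral_isArgmin i x t (hg i)]
  · intro i _
    exact (((hg i).comp (hclock i).ennreal_toReal).indicator (hset i)).aemeasurable

/-! ### Bounded solutions of the renewal equation -/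

@[simp] theorem Rates.total_zero (Λ : Rates d) (x : State d) : Λ.total x 0 = 0 := by
  simp [Rates.total]

theorem Rates.total_add (Λ : Rates d) (x : State d) (s t : ℝ) :
    Λ.total x (s + t) = Λ.total x s + Λ.total (flow x s) t := by
  simp [Rates.total, Λ.cumul_add, Finset.sum_add_distrib]

theorem Rates.hasDerivAt_total (Λ : Rates d) (x : State d) (t : ℝ) :
    HasDerivAt (Λ.total x) (∑ i, Λ.rate i (flow x t)) t :=
  HasDerivAt.fun_sum fun i _ => Λ.hasDerivAt_cumul i x t

/-- The density of the event that the first switch happens at time `s` in coordinate `i`. -/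
def Rates.density (Λ : Rates d) (i : Fin d) (x : State d) (s : ℝ) : ℝ :=
  Λ.rate i (flow x s) * Real.exp (-Λ.total x s)

theorem Rates.density_nonneg (Λ : Rates d) (i : Fin d) (x : State d) (s : ℝ) :
    0 ≤ Λ.density i x s := mul_nonneg (Λ.nonneg i _) (Real.exp_pos _).le

theorem Rates.continuous_density (Λ : Rates d) (i : Fin d) (x : State d) :
    Continuous (Λ.density i x) :=
  (Λ.continuous_rate_flow_right i x).mul (Real.continuous_exp.comp
    (continuous_finsetSum _ fun j _ => Λ.continuous_cumul_right j x).neg)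

theorem Rates.density_add (Λ : Rates d) (i : Fin d) (x : State d) (s r : ℝ) :
    Λ.density i x (s + r) = Real.exp (-Λ.total x s) * Λ.density i (flow x s) r := by
  rw [Rates.density, Rates.density, Λ.total_add, flow_add, neg_add, Real.exp_add]
  ring

theorem Rates.sum_integral_density (Λ : Rates d) (x : State d) (t : ℝ) :
    ∑ i, ∫ s in (0 : ℝ)..t, Λ.density i x s = 1 - Real.exp (-Λ.total x t) := by
  rw [← intervalIntegral.integral_finsetSum fun i _ =>
    (Λ.continuous_density i x).intervalIntegrable _ _,
    intervalIntegral.integral_eq_sub_of_hasDerivAt (f := fun s => -Real.exp (-Λ.total x s))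
    (fun s _ => ?_) ((continuous_finsetSum _ fun i _ =>
      Λ.continuous_density i x).intervalIntegrable _ _)]
  · simp; ring
  · refine ((Λ.hasDerivAt_total x s).neg.exp.neg).congr_deriv ?_
    simp [Rates.density, Finset.mul_sum, mul_comm]

/-- `u` is a measurable `[0, 1]`-valued solution of the renewal equation with initial value `f`. -/
structure Rates.IsSolution (Λ : Rates d) (f : State d → ℝ) (u : ℝ → State d → ℝ) : Prop where
  measurable : Measurable fun p : ℝ × State d => u p.1 p.2
  nonneg : ∀ t x, 0 ≤ u t x
  le_one : ∀ t x, u t x ≤ 1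
  renewal : ∀ t, 0 ≤ t → ∀ x, u t x = Real.exp (-Λ.total x t) * f (flow x t) +
    ∑ i, ∫ s in (0 : ℝ)..t, Λ.density i x s * u (t - s) (flip i (flow x s))

namespace Rates.IsSolution

variable {Λ : Rates d} {f : State d → ℝ} {u v : ℝ → State d → ℝ}

theorem measurable_along (hu : Λ.IsSolution f u) (i : Fin d) (x : State d) (t : ℝ) :
    Measurable fun s : ℝ => u (t - s) (flip i (flow x s)) := by
  have hp : Measurable fun s : ℝ => ((t - s, flip i (flow x s)) : ℝ × State d) :=
    Measurable.prodMk (by fun_prop)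
      ((measurable_flip i).comp (continuous_flow_right x).measurable)
  have h := hu.measurable.comp hp
  simp only [Function.comp_def] at h
  exact h

theorem intervalIntegrable (hu : Λ.IsSolution f u) (i : Fin d) (x : State d) (t a b : ℝ) :
    IntervalIntegrable (fun s => Λ.density i x s * u (t - s) (flip i (flow x s))) volume a b := by
  refine ((Λ.continuous_density i x).intervalIntegrable a b).mono_fun
    ((Λ.continuous_density i x).measurable.mul (hu.measurable_along i x t)).aestronglyMeasurable
    (Eventually.of_forall fun s => ?_)
  simp only [norm_mul]
  refine mul_le_of_le_one_right (norm_nonneg _) ?_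
  rw [Real.norm_of_nonneg (hu.nonneg _ _)]
  exact hu.le_one _ _

/-- Along a straight line, the discounted solution is a constant plus an integral over `[s, t]`.
This is the form to which the product rule applies. -/
theorem renewal_along (hu : Λ.IsSolution f u) (x : State d) {s t : ℝ} (hst : s ≤ t) :
    Real.exp (-Λ.total x s) * u (t - s) (flow x s) = Real.exp (-Λ.total x t) * f (flow x t) +
      ∑ i, ∫ r in s..t, Λ.density i x r * u (t - r) (flip i (flow x r)) := by
  have h1 : Λ.total x t = Λ.total x s + Λ.total (flow x s) (t - s) := by
    rw [← Λ.total_add, add_sub_cancel]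
  have h2 : flow x t = flow (flow x s) (t - s) := by rw [← flow_add, add_sub_cancel]
  rw [hu.renewal (t - s) (sub_nonneg.2 hst), mul_add, ← mul_assoc, ← Real.exp_add, h1, h2, neg_add,
    Finset.mul_sum]
  congr 1
  refine Finset.sum_congr rfl fun i _ => ?_
  have h3 := intervalIntegral.integral_comp_add_left
    (fun r => Λ.density i x r * u (t - r) (flip i (flow x r))) s (a := 0) (b := t - s)
  rw [add_zero, add_sub_cancel] at h3
  rw [← h3, ← intervalIntegral.integral_const_mul]
  refine intervalIntegral.integral_congr fun r _ => ?_
  simp only [Λ.density_add, flow_add, mul_assoc, sub_sub]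

/-- Solutions are unique: on the backward light cone of a point, the solution operator is a
contraction. -/
theorem unique (hu : Λ.IsSolution f u) (hv : Λ.IsSolution f v) {T : ℝ} (hT : 0 ≤ T)
    (x₀ : State d) : u T x₀ = v T x₀ := by
  obtain ⟨M, hM1, hM⟩ := Λ.exists_rate_bound x₀ T
  have hM0 : 0 ≤ M := by linarith
  -- On the cone the total integrated rate is at most `d * (M * T)`, so `q` bounds the probability
  -- of a switch.
  set q : ℝ := 1 - Real.exp (-(d * (M * T))) with hq
  have hq1 : q < 1 := by linarith [Real.exp_pos (-(d * (M * T)))]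
  have hq0 : 0 ≤ q := by
    have : Real.exp (-(d * (M * T))) ≤ 1 := Real.exp_le_one_iff.2 (by
      rw [neg_nonpos]; positivity)
    linarith
  have contract : ∀ B : ℝ, 0 ≤ B →
      (∀ t x, 0 ≤ t → t ≤ T → (∀ i, |x.1 i - x₀.1 i| ≤ T - t) → |u t x - v t x| ≤ B) →
      ∀ t x, 0 ≤ t → t ≤ T → (∀ i, |x.1 i - x₀.1 i| ≤ T - t) → |u t x - v t x| ≤ q * B := by
    intro B hB h t x ht htT hx
    -- Unit speed keeps the line inside the backward cone, and a flip leaves the position unchanged.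
    have hcone : ∀ s ∈ Set.Icc 0 t, ∀ i, |(flow x s).1 i - x₀.1 i| ≤ T - (t - s) := by
      intro s hs i
      have h1 := abs_flow_sub x i hs.1
      have h2 := abs_sub_le ((flow x s).1 i) (x.1 i) (x₀.1 i)
      linarith [hx i]
    have htot : Λ.total x t ≤ d * (M * T) := by
      calc Λ.total x t ≤ ∑ _i : Fin d, M * T := by
            refine Finset.sum_le_sum fun i _ => ?_
            refine (Λ.cumul_le i x ht fun s hs => hM _ (fun j => ?_) i).trans
              (mul_le_mul_of_nonneg_left htT hM0)
            linarith [hcone s hs j, hs.2]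
        _ = _ := by simp
    rw [hu.renewal t ht, hv.renewal t ht, add_sub_add_left_eq_sub, ← Finset.sum_sub_distrib]
    calc |∑ i, ((∫ s in (0 : ℝ)..t, Λ.density i x s * u (t - s) (flip i (flow x s))) -
          ∫ s in (0 : ℝ)..t, Λ.density i x s * v (t - s) (flip i (flow x s)))|
        ≤ ∑ i, ∫ s in (0 : ℝ)..t, Λ.density i x s * B := by
          refine (Finset.abs_sum_le_sum_abs _ _).trans (Finset.sum_le_sum fun i _ => ?_)
          rw [← intervalIntegral.integral_sub (hu.intervalIntegrable i x t 0 t)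
            (hv.intervalIntegrable i x t 0 t), ← Real.norm_eq_abs]
          refine intervalIntegral.norm_integral_le_of_norm_le ht (Eventually.of_forall
            fun s hs => ?_) (((Λ.continuous_density i x).mul continuous_const).intervalIntegrable
              0 t)
          rw [← mul_sub, norm_mul, Real.norm_of_nonneg (Λ.density_nonneg i x s)]
          refine mul_le_mul_of_nonneg_left ?_ (Λ.density_nonneg i x s)
          exact h (t - s) _ (by linarith [hs.2]) (by linarith [hs.1])
            (hcone s ⟨hs.1.le, hs.2⟩)
      _ = (1 - Real.exp (-Λ.total x t)) * B := by
          simp_rw [intervalIntegral.integral_mul_const]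
          rw [← Finset.sum_mul, Λ.sum_integral_density]
      _ ≤ q * B := by
          refine mul_le_mul_of_nonneg_right ?_ hB
          rw [hq]
          linarith [Real.exp_le_exp.2 (neg_le_neg htot)]
  have iter : ∀ n : ℕ, ∀ t x, 0 ≤ t → t ≤ T → (∀ i, |x.1 i - x₀.1 i| ≤ T - t) →
      |u t x - v t x| ≤ q ^ n := by
    intro n
    induction n with
    | zero =>
      intro t x _ _ _
      rw [pow_zero, abs_le]
      constructor <;> linarith [hu.nonneg t x, hu.le_one t x, hv.nonneg t x, hv.le_one t x]
    | succ n ih =>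
      rw [pow_succ']
      exact contract _ (pow_nonneg hq0 n) ih
  have hle : |u T x₀ - v T x₀| ≤ 0 := ge_of_tendsto'
    (tendsto_pow_atTop_nhds_zero_of_lt_one hq0 hq1) fun n => iter n T x₀ hT le_rfl (by simp)
  exact sub_eq_zero.1 (abs_nonpos_iff.1 hle)

/-- The integral over `[0, t + h]` splits at `t`; by `renewal_along`, the part after `t` and the
free term combine to the discounted value `u h`. -/
theorem shift (hu : Λ.IsSolution f u) {h : ℝ} (hh : 0 ≤ h) :
    Λ.IsSolution (u h) fun t x => u (t + h) x where
  measurable := by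
    have hp : Measurable fun p : ℝ × State d => ((p.1 + h, p.2) : ℝ × State d) := by fun_prop
    have := hu.measurable.comp hp
    simp only [Function.comp_def] at this
    exact this
  nonneg _ _ := hu.nonneg _ _
  le_one _ _ := hu.le_one _ _
  renewal t ht x := by
    have h1 := hu.renewal_along x (s := t) (t := t + h) (by linarith)
    rw [add_sub_cancel_left] at h1
    rw [h1, hu.renewal (t + h) (by linarith), add_assoc, ← Finset.sum_add_distrib]
    congr 1
    refine Finset.sum_congr rfl fun i _ => ?_
    rw [← intervalIntegral.integral_add_adjacent_intervals
      (hu.intervalIntegrable i x (t + h) 0 t) (hu.intervalIntegrable i x (t + h) t (t + h))]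
    simp_rw [sub_add_eq_add_sub]
    exact add_comm _ _

end Rates.IsSolution

theorem Rates.semigroup_le_one (Λ : Rates d) {f : State d → ℝ≥0∞} (hf1 : ∀ x, f x ≤ 1) (t : ℝ≥0)
    (x : State d) : Λ.semigroup f t x ≤ 1 :=
  (lintegral_mono hf1).trans (by simp)

theorem Rates.isSolution_semigroup (Λ : Rates d) {f : State d → ℝ≥0∞} (hf : Measurable f)
    (hf1 : ∀ x, f x ≤ 1) :
    Λ.IsSolution (fun x => (f x).toReal) fun t x => (Λ.semigroup f t.toNNReal x).toReal where
  measurable := by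
    have hp : Measurable fun p : ℝ × State d => ((p.1.toNNReal, p.2) : ℝ≥0 × State d) := by
      fun_prop
    have := ((Λ.measurable_semigroup hf).comp hp).ennreal_toReal
    simp only [Function.comp_def] at this
    exact this
  nonneg _ _ := ENNReal.toReal_nonneg
  le_one t x := by
    simpa using ENNReal.toReal_mono ENNReal.one_ne_top (Λ.semigroup_le_one hf1 t.toNNReal x)
  renewal t ht x := by
    lift t to ℝ≥0 using ht
    have hS : ∀ t x, Λ.semigroup f t x ≠ ∞ := fun t x =>
      ((Λ.semigroup_le_one hf1 t x).trans_lt ENNReal.one_lt_top).ne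
    have hr := Λ.semigroup_renewal hf t x
    have hfin := hr ▸ hS t x
    have hfin1 := (ENNReal.add_ne_top.1 hfin).1
    have hfin2 := (ENNReal.add_ne_top.1 hfin).2
    rw [Real.toNNReal_coe, hr, ENNReal.toReal_add hfin1 hfin2, ENNReal.toReal_mul,
      ENNReal.toReal_ofReal (Real.exp_pos _).le, ENNReal.toReal_sum (ENNReal.sum_ne_top.1 hfin2)]
    congr 1
    refine Finset.sum_congr rfl fun i _ => ?_
    have hp : Measurable fun s : ℝ => ((((t : ℝ) - s).toNNReal, flip i (flow x s)) : ℝ≥0 × State d) :=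
      Measurable.prodMk (by fun_prop)
        ((measurable_flip i).comp (continuous_flow_right x).measurable)
    have hm := ((Λ.measurable_semigroup hf).comp hp).ennreal_toReal
    simp only [Function.comp_def] at hm
    rw [intervalIntegral.integral_of_le t.coe_nonneg, integral_eq_lintegral_of_nonneg_ae
      (Eventually.of_forall fun s => mul_nonneg (Λ.density_nonneg i x s) ENNReal.toReal_nonneg)
      ((Λ.continuous_density i x).measurable.mul hm).aestronglyMeasurable]
    congr 1
    refine setLIntegral_congr_fun measurableSet_Ioc fun s hs => ?_
    rw [ENNReal.ofReal_mul (Λ.density_nonneg i x s), ENNReal.ofReal_toReal (hS _ _),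
      show ((t : ℝ) - s).toNNReal = t - s.toNNReal by
        rw [NNReal.sub_def, Real.coe_toNNReal _ hs.1.le]]
    rfl

/-- As functions of `t`, both sides solve the renewal equation with initial value `Λ.semigroup f h`.
-/
theorem Rates.semigroup_add (Λ : Rates d) {f : State d → ℝ≥0∞} (hf : Measurable f)
    (hf1 : ∀ x, f x ≤ 1) (t h : ℝ≥0) (x : State d) :
    Λ.semigroup f (t + h) x = Λ.semigroup (Λ.semigroup f h) t x := by
  have hS : Measurable (Λ.semigroup f h) := by
    have := (Λ.measurable_semigroup hf).comp (measurable_prodMk_left (x := h))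
    simp only [Function.comp_def] at this
    exact this
  have hS1 := Λ.semigroup_le_one hf1 h
  have h1 := (Λ.isSolution_semigroup hf hf1).shift h.coe_nonneg
  simp only [Real.toNNReal_coe] at h1
  have key := h1.unique (Λ.isSolution_semigroup hS hS1) t.coe_nonneg x
  simp only [← NNReal.coe_add, Real.toNNReal_coe] at key
  exact (ENNReal.toReal_eq_toReal_iff' ((Λ.semigroup_le_one hf1 _ x).trans_lt
    ENNReal.one_lt_top).ne ((Λ.semigroup_le_one hS1 _ x).trans_lt ENNReal.one_lt_top).ne).1 key

theorem Rates.semigroup_indicator (Λ : Rates d) {A : Set (State d)} (hA : MeasurableSet A)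
    (t : ℝ≥0) (x : State d) : Λ.semigroup (A.indicator 1) t x = Λ.transition t x A :=
  lintegral_indicator_one hA

/-- The Chapman–Kolmogorov equation. -/
theorem Rates.transition_add (Λ : Rates d) (t h : ℝ≥0) :
    Λ.transition (t + h) = Λ.transition h ∘ₖ Λ.transition t := by
  ext x A hA
  rw [Kernel.comp_apply' _ _ _ hA, ← Λ.semigroup_indicator hA, Λ.semigroup_add
    (measurable_one.indicator hA) fun y => Set.indicator_le_self' (fun _ _ => zero_le) y]
  exact lintegral_congr fun y => Λ.semigroup_indicator hA h y

/-! ### Products of one-dimensional processes -/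

theorem absolutelyContinuousOnInterval_prod {ι : Type*} (S : Finset ι) {W : ι → ℝ → ℝ} {a b : ℝ}
    (hW : ∀ i, AbsolutelyContinuousOnInterval (W i) a b) :
    AbsolutelyContinuousOnInterval (fun s => ∏ i ∈ S, W i s) a b := by
  classical
  induction S using Finset.induction_on with
  | empty =>
    simp only [Finset.prod_empty]
    exact contDiffOn_const.absolutelyContinuousOnInterval
  | insert i S hi ih =>
    simp only [Finset.prod_insert hi]
    exact (hW i).fun_mul ih

/-- The product rule for integral functions. -/
theorem prod_eq_add_sum_integral {ι : Type*} [Fintype ι] [DecidableEq ι] {t : ℝ} (ht : 0 ≤ t)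
    {w h : ι → ℝ → ℝ} (c : ι → ℝ) (hh : ∀ i, IntervalIntegrable (h i) volume 0 t)
    (hw : ∀ i, ∀ s ∈ Set.Icc 0 t, w i s = c i + ∫ r in s..t, h i r) :
    ∏ i, w i 0 = ∏ i, w i t + ∑ i, ∫ s in (0 : ℝ)..t, h i s * ∏ j ∈ Finset.univ.erase i, w j s := by
  -- `W` agrees with `w` on `[0, t]` and is absolutely continuous. The `h i` are merely integrable,
  -- so the derivative exists only almost everywhere and the fundamental theorem is used in its
  -- absolutely continuous form.
  set W : ι → ℝ → ℝ := fun i s => (c i + ∫ r in (0 : ℝ)..t, h i r) - ∫ r in (0 : ℝ)..s, h i r with hWdef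
  have hsub : ∀ {a b : ℝ}, a ∈ Set.Icc 0 t → b ∈ Set.Icc 0 t → ∀ i,
      IntervalIntegrable (h i) volume a b := fun ha hb i =>
    (hh i).mono_set (by rw [Set.uIcc_of_le ht]; exact Set.uIcc_subset_Icc ha hb)
  have hwW : ∀ i, ∀ s ∈ Set.Icc 0 t, w i s = W i s := fun i s hs => by
    rw [hw i s hs]
    simp only [hWdef]
    rw [← intervalIntegral.integral_add_adjacent_intervals
      (hsub (Set.left_mem_Icc.2 ht) hs i) (hsub hs (Set.right_mem_Icc.2 ht) i)]
    ring
  have hWac : ∀ i, AbsolutelyContinuousOnInterval (W i) 0 t := fun i =>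
    (contDiffOn_const.absolutelyContinuousOnInterval).fun_sub
      ((hh i).absolutelyContinuousOnInterval_intervalIntegral Set.left_mem_uIcc)
  have hderiv : ∀ᵐ s, s ∈ Set.uIoc 0 t → deriv (fun s => ∏ i, W i s) s =
      ∑ i, -(h i s * ∏ j ∈ Finset.univ.erase i, w j s) := by
    have hae : ∀ᵐ s, ∀ i, s ∈ Set.uIcc 0 t → ∀ c ∈ Set.uIcc 0 t,
        HasDerivAt (fun x => ∫ r in c..x, h i r) (h i s) s :=
      ae_all_iff.2 fun i => (hh i).ae_hasDerivAt_integral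
    filter_upwards [hae] with s hs hmem
    have hs' : s ∈ Set.uIcc 0 t := Set.uIoc_subset_uIcc hmem
    have hsI : s ∈ Set.Icc 0 t := by rwa [Set.uIcc_of_le ht] at hs'
    have hd : ∀ i ∈ Finset.univ, HasDerivAt (W i) (-h i s) s := fun i _ =>
      (hs i hs' 0 Set.left_mem_uIcc).const_sub _
    rw [(HasDerivAt.fun_finsetProd hd).deriv]
    refine Finset.sum_congr rfl fun i _ => ?_
    rw [Finset.prod_congr rfl fun j _ => (hwW j s hsI).symm, smul_eq_mul]
    ring
  have hint : ∀ i, IntervalIntegrable (fun s => h i s * ∏ j ∈ Finset.univ.erase i, w j s)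
      volume 0 t := fun i => by
    have := (hh i).mul_continuousOn
      (absolutelyContinuousOnInterval_prod (Finset.univ.erase i) hWac).continuousOn
    refine this.congr fun s hs => ?_
    have hsI : s ∈ Set.Icc 0 t := by
      rw [← Set.uIcc_of_le ht]; exact Set.uIoc_subset_uIcc hs
    rw [Finset.prod_congr rfl fun j _ => (hwW j s hsI).symm]
  have h1 := (absolutelyContinuousOnInterval_prod Finset.univ hWac).integral_deriv_eq_sub
  rw [intervalIntegral.integral_congr_ae hderiv, intervalIntegral.integral_finsetSum
    (f := fun i s => -(h i s * ∏ j ∈ Finset.univ.erase i, w j s)) fun i _ => (hint i).neg] at h1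
  simp only [intervalIntegral.integral_neg, Finset.sum_neg_distrib] at h1
  rw [Finset.prod_congr rfl fun i _ => hwW i 0 (Set.left_mem_Icc.2 ht),
    Finset.prod_congr rfl fun i _ => hwW i t (Set.right_mem_Icc.2 ht)]
  linarith

/-- The state of the `i`-th coordinate. -/
def proj (i : Fin d) (x : State d) : State 1 := (fun _ => x.1 i, fun _ => x.2 i)

theorem measurable_proj (i : Fin d) : Measurable (proj i : State d → State 1) := by
  unfold proj
  fun_prop

theorem proj_flow (i : Fin d) (x : State d) (s : ℝ) : proj i (flow x s) = flow (proj i x) s := rfl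

theorem proj_flip_self (i : Fin d) (x : State d) : proj i (flip i x) = flip 0 (proj i x) := by
  ext j
  · rfl
  · rw [Subsingleton.elim j 0]; simp [proj, flip]

theorem proj_flip_of_ne {i j : Fin d} (h : j ≠ i) (x : State d) : proj j (flip i x) = proj j x := by
  ext k
  · rfl
  · simp [proj, flip, Function.update_of_ne h]

/-- The rates `Λ` are those of independent one-dimensional processes with rates `Λ₁ i`. -/
def Rates.Decouples (Λ : Rates d) (Λ₁ : Fin d → Rates 1) : Prop :=
  ∀ i x, Λ.rate i x = (Λ₁ i).rate 0 (proj i x)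

namespace Rates.Decouples

variable {Λ : Rates d} {Λ₁ : Fin d → Rates 1}

theorem total_eq (hΛ : Λ.Decouples Λ₁) (x : State d) (t : ℝ) :
    Λ.total x t = ∑ i, (Λ₁ i).total (proj i x) t := by
  simp only [Rates.total, Rates.cumul, hΛ _ _, proj_flow, Finset.univ_unique, Finset.sum_singleton]
  rfl

/-- Apply the product rule to the discounted one-dimensional solutions. The term differentiating
factor `i` is a switch in coordinate `i`, which leaves the other factors alone; the discounts
multiply to `exp (-total)`. -/
theorem isSolution_prod (hΛ : Λ.Decouples Λ₁) {f : Fin d → State 1 → ℝ}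
    {u : Fin d → ℝ → State 1 → ℝ} (hu : ∀ i, (Λ₁ i).IsSolution (f i) (u i)) :
    Λ.IsSolution (fun x => ∏ i, f i (proj i x)) fun t x => ∏ i, u i t (proj i x) where
  measurable := by
    refine Finset.measurable_prod _ fun i _ => ?_
    have hp : Measurable fun p : ℝ × State d => ((p.1, proj i p.2) : ℝ × State 1) :=
      measurable_fst.prodMk ((measurable_proj i).comp measurable_snd)
    have := (hu i).measurable.comp hp
    simp only [Function.comp_def] at this
    exact this
  nonneg t x := Finset.prod_nonneg fun i _ => (hu i).nonneg _ _
  le_one t x := Finset.prod_le_one (fun i _ => (hu i).nonneg _ _) fun i _ => (hu i).le_one _ _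
  renewal t ht x := by
    set h : Fin d → ℝ → ℝ := fun i s =>
      (Λ₁ i).density 0 (proj i x) s * u i (t - s) (flip 0 (flow (proj i x) s)) with hh
    set w : Fin d → ℝ → ℝ := fun i s =>
      Real.exp (-(Λ₁ i).total (proj i x) s) * u i (t - s) (flow (proj i x) s) with hw
    have key := prod_eq_add_sum_integral ht (w := w) (h := h)
      (fun i => Real.exp (-(Λ₁ i).total (proj i x) t) * f i (flow (proj i x) t))
      (fun i => (hu i).intervalIntegrable 0 (proj i x) t 0 t) fun i s hs => by
        have := (hu i).renewal_along (proj i x) hs.2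
        simp only [Finset.univ_unique, Finset.sum_singleton] at this
        exact this
    have hu0 : ∀ i y, u i 0 y = f i y := fun i y => by
      rw [(hu i).renewal 0 le_rfl]
      simp
    have h0 : ∏ i, w i 0 = ∏ i, u i t (proj i x) := by simp [hw]
    have h1 : ∏ i, w i t = Real.exp (-Λ.total x t) * ∏ i, f i (proj i (flow x t)) := by
      simp only [hw, sub_self, hu0, Finset.prod_mul_distrib, ← Real.exp_sum,
        Finset.sum_neg_distrib, ← hΛ.total_eq, proj_flow]
    rw [h0, h1] at key
    rw [key]
    congr 1
    refine Finset.sum_congr rfl fun i _ => intervalIntegral.integral_congr fun s _ => ?_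
    have herase : ∏ j ∈ Finset.univ.erase i, u j (t - s) (proj j (flip i (flow x s))) =
        ∏ j ∈ Finset.univ.erase i, u j (t - s) (proj j (flow x s)) :=
      Finset.prod_congr rfl fun j hj => by rw [proj_flip_of_ne (Finset.ne_of_mem_erase hj)]
    rw [← Finset.mul_prod_erase Finset.univ (fun j => u j (t - s) (proj j (flip i (flow x s))))
      (Finset.mem_univ i), proj_flip_self, herase]
    simp only [hw, hh, Rates.density, Finset.prod_mul_distrib, hΛ.total_eq, hΛ i, proj_flow]
    rw [← Finset.sum_neg_distrib, Real.exp_sum, ← Finset.mul_prod_erase Finset.univ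
      (fun j => Real.exp (-(Λ₁ j).total (proj j x) s)) (Finset.mem_univ i)]
    ring

end Rates.Decouples

/-- The identification of `E` with a product of one-dimensional state spaces. -/
def coords (x : State d) : Fin d → State 1 := fun i => proj i x

/-- The inverse of `coords`. -/
def ofCoords (y : Fin d → State 1) : State d := (fun i => (y i).1 0, fun i => (y i).2 0)

theorem measurable_coords : Measurable (coords : State d → Fin d → State 1) :=
  measurable_pi_lambda _ measurable_proj

theorem measurable_ofCoords : Measurable (ofCoords : (Fin d → State 1) → State d) := by
  unfold ofCoords
  fun_prop

/-- With decoupled rates, the transition probabilities are products of one-dimensional ones. -/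
theorem Rates.Decouples.map_transition {Λ : Rates d} {Λ₁ : Fin d → Rates 1}
    (hΛ : Λ.Decouples Λ₁) (t : ℝ≥0) (x : State d) :
    (Λ.transition t x).map coords = Measure.pi fun i => (Λ₁ i).transition t (proj i x) := by
  refine (Measure.pi_eq fun A hA => ?_).symm
  have hAm : MeasurableSet (Set.univ.pi A) := MeasurableSet.univ_pi hA
  rw [Measure.map_apply measurable_coords hAm]
  -- Product of the one-dimensional probabilities of the sides of the box; `hsol'` is the
  -- probability of the box. Their initial values agree by `hf`, so uniqueness applies.
  have hsol := hΛ.isSolution_prod fun i => (Λ₁ i).isSolution_semigroup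
    (measurable_one.indicator (hA i)) (f := (A i).indicator 1)
    fun y => Set.indicator_le_self' (fun _ _ => zero_le) y
  have hB : MeasurableSet (coords ⁻¹' Set.univ.pi A) := measurable_coords hAm
  have hsol' := Λ.isSolution_semigroup (measurable_one.indicator hB)
    fun y => Set.indicator_le_self' (fun _ _ => zero_le) y
  have hf : (fun x : State d => ∏ i, ((A i).indicator (1 : State 1 → ℝ≥0∞) (proj i x)).toReal) =
      fun x => ((coords ⁻¹' Set.univ.pi A).indicator (1 : State d → ℝ≥0∞) x).toReal := by
    funext y
    by_cases hy : ∀ i, proj i y ∈ A i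
    · rw [Set.indicator_of_mem (show y ∈ coords ⁻¹' Set.univ.pi A from fun i _ => hy i)]
      simp [hy]
    · rw [Set.indicator_of_notMem (show y ∉ coords ⁻¹' Set.univ.pi A from
        fun h => hy fun i => h i (Set.mem_univ i))]
      obtain ⟨i, hi⟩ := not_forall.1 hy
      exact Finset.prod_eq_zero (Finset.mem_univ i) (by simp [hi])
  rw [hf] at hsol
  have := hsol'.unique hsol t.coe_nonneg x
  simp only [Real.toNNReal_coe, Λ.semigroup_indicator hB, (Λ₁ _).semigroup_indicator (hA _),
    ← ENNReal.toReal_prod] at this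
  exact (ENNReal.toReal_eq_toReal_iff' (measure_ne_top _ _)
    (ENNReal.prod_ne_top fun i _ => measure_ne_top _ _)).1 this

/-! ### Mixing and invariant distributions -/

theorem Rates.transition_zero (Λ : Rates d) : Λ.transition 0 = Kernel.id := by
  ext x A hA
  have hind := measurable_one.indicator hA (f := (1 : State d → ℝ≥0∞))
  rw [← Λ.semigroup_indicator hA, Λ.semigroup_renewal hind, Kernel.id_apply,
    Measure.dirac_apply' _ hA]
  simp

theorem Rates.transition_pow (Λ : Rates d) (δ : ℝ≥0) (k : ℕ) :
    Λ.transition δ ^ k = Λ.transition (k * δ) := by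
  induction k with
  | zero => rw [Nat.cast_zero, zero_mul, Λ.transition_zero]; rfl
  | succ k ih =>
    rw [pow_succ, ih, Nat.cast_add, Nat.cast_one, add_mul, one_mul, add_comm, Λ.transition_add]
    rfl

theorem isMixing_iff_transition (Λ : Rates d) (δ : ℝ≥0) :
    IsMixing (Λ.transition δ) ↔ ∃ (μ : Measure (State d)) (_ : IsProbabilityMeasure μ),
      ∀ x, Tendsto (fun k : ℕ => tvNorm (Λ.transition (k * δ) x) μ) atTop (𝓝 0) := by
  simp only [IsMixing, Λ.transition_pow]

theorem Rates.Decouples.isMixing {Λ : Rates d} {Λ₁ : Fin d → Rates 1} (hΛ : Λ.Decouples Λ₁)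
    (δ : ℝ≥0) (hmix : ∀ i, IsMixing ((Λ₁ i).transition δ)) : IsMixing (Λ.transition δ) := by
  simp only [isMixing_iff_transition] at hmix ⊢
  choose ν hν hlim using hmix
  have hprob : IsProbabilityMeasure ((Measure.pi ν).map ofCoords) :=
    Measure.isProbabilityMeasure_map measurable_ofCoords.aemeasurable
  refine ⟨(Measure.pi ν).map ofCoords, hprob, fun x => ?_⟩
  have hbound : ∀ k : ℕ, tvNorm (Λ.transition (k * δ) x) ((Measure.pi ν).map ofCoords) ≤
      2 * ∑ i, tvNorm ((Λ₁ i).transition (k * δ) (proj i x)) (ν i) := by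
    intro k
    refine ExcessLE.tvNorm_le ?_
    have h1 := (ExcessLE.pi fun i => excessLE_tvNorm ((Λ₁ i).transition (k * δ) (proj i x))
      (ν i)).map measurable_ofCoords
    rwa [← hΛ.map_transition, Measure.map_map measurable_ofCoords measurable_coords,
      show (ofCoords ∘ coords : State d → State d) = id from rfl, Measure.map_id] at h1
  refine tendsto_of_tendsto_of_tendsto_of_le_of_le tendsto_const_nhds ?_ (fun _ => zero_le) hbound
  have hsum := tendsto_finsetSum Finset.univ fun i _ => hlim i (proj i x)
  rw [Finset.sum_const_zero] at hsum
  simpa using ENNReal.Tendsto.const_mul hsum (Or.inr ENNReal.ofNat_ne_top) (a := 2)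

theorem tendsto_bind_of_tvNorm {E : Type*} [MeasurableSpace E] {κ : ℕ → Kernel E E}
    [∀ k, IsMarkovKernel (κ k)] {ν : Measure E} [IsProbabilityMeasure ν]
    (h : ∀ x, Tendsto (fun k => tvNorm (κ k x) ν) atTop (𝓝 0)) (m : Measure E)
    [IsProbabilityMeasure m] {A : Set E} (hA : MeasurableSet A) :
    Tendsto (fun k => m.bind (κ k) A) atTop (𝓝 (ν A)) := by
  simp_rw [fun k => Measure.bind_apply hA (κ k).aemeasurable (m := m)]
  have := tendsto_lintegral_of_dominated_convergence (μ := m) (F := fun k x => κ k x A)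
    (f := fun _ => ν A) (fun _ => 1) (fun k => (κ k).measurable_coe hA)
    (fun k => Eventually.of_forall fun x => prob_le_one) (by simp)
    (Eventually.of_forall fun x => tendsto_apply_of_tvNorm (h x) A)
  simpa using this

/-- Starting from `x`, run time `t` and `kδ` in either order: one order tends to `ν`, the other to
`ν P^t`. An invariant `μ` equals `μ P^(kδ)`, which tends to `ν`. -/
theorem Rates.existsUnique_isInvariant (Λ : Rates d) {δ : ℝ≥0}
    (hmix : IsMixing (Λ.transition δ)) : ∃! μ : Measure (State d), Λ.IsInvariant μ := by
  obtain ⟨ν, hν, hlim⟩ := (isMixing_iff_transition Λ δ).1 hmix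
  refine ⟨ν, ⟨hν, fun t => ?_⟩, ?_⟩
  · have x : State d := (0, 1)
    have hprob : IsProbabilityMeasure (ν.bind (Λ.transition t)) := inferInstance
    -- Between probability measures an inequality is an equality, so only `ν ≤ ν P^t` is needed.
    refine (Measure.eq_of_le_of_isProbabilityMeasure (Measure.le_iff.2 fun A hA => ?_)).symm
    have h1 := tendsto_bind_of_tvNorm hlim (Λ.transition t x) hA
    have h2 : ∀ k : ℕ, (Λ.transition t x).bind (Λ.transition (k * δ)) A ≤
        ν.bind (Λ.transition t) A + tvNorm (Λ.transition (k * δ) x) ν := by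
      intro k
      have h3 : (Λ.transition t x).bind (Λ.transition (k * δ)) =
          (Λ.transition (k * δ) x).bind (Λ.transition t) := by
        rw [← Kernel.comp_apply, ← Kernel.comp_apply, ← Λ.transition_add, ← Λ.transition_add,
          add_comm]
      rw [h3]
      exact ((excessLE_tvNorm _ _).bind (Λ.transition t)).apply_le A
    refine le_of_tendsto_of_tendsto' h1 ?_ h2
    simpa using (tendsto_const_nhds (x := ν.bind (Λ.transition t) A)).add (hlim x)
  · rintro μ ⟨hμ, hinv⟩
    ext A hA
    have h1 := tendsto_bind_of_tvNorm hlim μ hA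
    simp_rw [fun k : ℕ => (hinv (k * δ)).def] at h1
    exact tendsto_nhds_unique tendsto_const_nhds h1

end ZigZag

end

theorem proposition2p5 {d : ℕ} (π Ψ : (Fin d → ℝ) → ℝ) (hΨ : ZigZag.IsNegLogDensity Ψ π)
    (hπ : ZigZag.IsProductForm π)
    (ψ : Fin d → ℝ → ℝ) (hψ : ∀ ξ, Ψ ξ = ∑ i, ψ i (ξ i))
    (γ : Fin d → ℝ → ℝ) (hγ : ∀ i u, 0 ≤ γ i u)
    (Λ : ZigZag.Rates d)
    (hΛ : ∀ i ξ θ, Λ.rate i (ξ, θ) = max (ZigZag.sgn (θ i) * deriv (ψ i) (ξ i)) 0 + γ i (ξ i))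
    (Λ₁ : Fin d → ZigZag.Rates 1)
    (hΛ₁ : ∀ i ξ θ,
      (Λ₁ i).rate 0 (ξ, θ) = max (ZigZag.sgn (θ 0) * deriv (ψ i) (ξ 0)) 0 + γ i (ξ 0))
    (δ : ℝ≥0) (hδ : 0 < δ)
    (hmix : ∀ i, ZigZag.IsMixing ((Λ₁ i).transition δ)) :
    ZigZag.IsMixing (Λ.transition δ) ∧ ∃! μ : Measure (ZigZag.State d), Λ.IsInvariant μ := by
  -- The form of the rates enters here: `λ_i` at `x` is the one-dimensional rate at the `i`-th
  -- coordinate of `x`.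
  have hdec : Λ.Decouples Λ₁ := fun i x => (hΛ i x.1 x.2).trans (hΛ₁ i (fun _ => x.1 i) fun _ => x.2 i).symm
  have h := hdec.isMixing δ hmix
  exact ⟨h, Λ.existsUnique_isInvariant h⟩
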